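/- Let $T>0$, let $\mathcal O\subset\mathbb R$ be open with closure $\bar{\mathcal O}$, and let $A\subset\mathbb R$ be compact and nonempty. Assume the following. (1) $b:[0,T]\times\mathbb R\times A\to\mathbb R$ and $\sigma:[0,T]\times\mathbb R\times A\to[0,\infty)$ are Borel measurable, bounded, and Lipschitz in $x$ uniformly in $(t,a)$; moreover, for each $t\in[0,T]$, the functions $(x,a)\mapsto b(t,x,a)$ and $(x,a)\mapsto\sigma(t,x,a)$ are continuous on $\bar{\mathcal O}\times A$. (2) $f:[0,T]\times\bar{\mathcal O}\times A\to\mathbb R$ is Borel measurable and bounded, and $f(t,\cdot)$ is upper semicontinuous on $\bar{\mathcal O}\times A$ for each $t$; $g:[0,T]\times\bar{\mathcal O}\to\mathbb R$ is upper semicontinuous and bounded from above. (3) $m_0^*$ is a Borel probability measure on $\mathcal O$ with $\int_{\mathcal O}\ln(1+|x|)\,m_0^*(dx)<\infty$. Let $V$ be the set of flows $m=(m_t)_{t\in[0,T]}$ of finite positive Borel measures on $\bar{\mathcal O}\times A$ such that $t\mapsto m_t(B)$ is measurable for every Borel set $B$ and $\int_0^T m_t(\bar{\mathcal O}\times A)\,dt<\infty$,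 where flows that agree for almost every $t$ are identified. Let $C_b^{1,2}([0,T]\times\bar{\mathcal O})$ be the set of bounded continuous functions $u$ on $[0,T]\times\bar{\mathcal O}$ whose derivatives $\partial_tu,\partial_xu,\partial_{xx}u$ (taken within $[0,T]$ and $\bar{\mathcal O}$) exist and are bounded and continuous on $[0,T]\times\bar{\mathcal O}$. Let $\mathcal R$ be the set of pairs $(\mu,m)$, with $\mu$ a Borel probability measure on $[0,T]\times\bar{\mathcal O}$ and $m\in V$, such that for all $u\in C_b^{1,2}([0,T]\times\bar{\mathcal O})$ $$\int_{[0,T]\times\bar{\mathcal O}}u\,d\mu=\int_{\mathcal O}u(0,x)\,m_0^*(dx)+\int_0^T\!\!\int_{\bar{\mathcal O}\times A}\Big(\partial_tu(t,x)+b(t,x,a)\,\partial_xu(t,x)+\tfrac{\sigma^2(t,x,a)}{2}\,\partial_{xx}u(t,x)\Big)m_t(dx,da)\,dt.$$ The linear programming (LP) problem is to maximize over $(\mu,m)\in\mathcal R$ $$\Gamma(\mu,m)=\int_0^T\!\!\int_{\bar{\mathcal O}\times A}f(t,x,a)\,m_t(dx,da)\,dt+\int_{[0,T]\times\bar{\mathcal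 O}}g\,d\mu\ \in\ \mathbb R\cup\{-\infty\}.$$ **Proposition (existence of a strict control LP solution).** Suppose that for all $(t,x)\in[0,T]\times\bar{\mathcal O}$ the set $$K(t,x)=\{(b(t,x,a),\sigma^2(t,x,a),z):\ a\in A,\ z\le f(t,x,a)\}\subset\mathbb R\times\mathbb R_+\times\mathbb R$$ is convex. Then there exist $(\mu,m)\in\mathcal R$ that maximizes $\Gamma$ over $\mathcal R$ and a Borel measurable function $\alpha:[0,T]\times\bar{\mathcal O}\to A$ such that $$m_t(dx,da)=\delta_{\alpha(t,x)}(da)\,m_t(dx,A),\qquad t\in[0,T],$$ for a suitable representative of $m$, where $m_t(dx,A)=\int_A m_t(dx,da)$. -/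

import Mathlib

open MeasureTheory ProbabilityTheory
open scoped ENNReal

namespace LPControl

/-- `IsC12b T O u ut ux uxx` says that (the restriction to `[0, T] × closure O` of) `u` belongs to
`C_b^{1,2}([0, T] × closure O)` and that its derivatives `∂ₜu`, `∂ₓu`, `∂ₓₓu` are `ut`, `ux`, `uxx`:
all four functions are continuous and bounded on `[0, T] × closure O`, and the derivatives are
taken within `[0, T]` and within `closure O` (one-sided at boundary points). For `0 < T` and `O`
open these sets have no isolated points, so `u` determines `ut`, `ux`, `uxx` there. The values of
the functions outside `[0, T] × closure O` play no role. -/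
structure IsC12b (T : ℝ) (O : Set ℝ) (u ut ux uxx : ℝ → ℝ → ℝ) : Prop where
  continuousOn_u : ContinuousOn (Function.uncurry u) (Set.Icc 0 T ×ˢ closure O)
  continuousOn_ut : ContinuousOn (Function.uncurry ut) (Set.Icc 0 T ×ˢ closure O)
  continuousOn_ux : ContinuousOn (Function.uncurry ux) (Set.Icc 0 T ×ˢ closure O)
  continuousOn_uxx : ContinuousOn (Function.uncurry uxx) (Set.Icc 0 T ×ˢ closure O)
  bounded_u : ∃ C : ℝ, ∀ t ∈ Set.Icc 0 T, ∀ x ∈ closure O, |u t x| ≤ C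
  bounded_ut : ∃ C : ℝ, ∀ t ∈ Set.Icc 0 T, ∀ x ∈ closure O, |ut t x| ≤ C
  bounded_ux : ∃ C : ℝ, ∀ t ∈ Set.Icc 0 T, ∀ x ∈ closure O, |ux t x| ≤ C
  bounded_uxx : ∃ C : ℝ, ∀ t ∈ Set.Icc 0 T, ∀ x ∈ closure O, |uxx t x| ≤ C
  deriv_t : ∀ t ∈ Set.Icc 0 T, ∀ x ∈ closure O,
    HasDerivWithinAt (fun s => u s x) (ut t x) (Set.Icc 0 T) t
  deriv_x : ∀ t ∈ Set.Icc 0 T, ∀ x ∈ closure O,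
    HasDerivWithinAt (fun y => u t y) (ux t x) (closure O) x
  deriv_xx : ∀ t ∈ Set.Icc 0 T, ∀ x ∈ closure O,
    HasDerivWithinAt (fun y => ux t y) (uxx t x) (closure O) x

/-- The class `𝒮` of bounded measurable functions `h : [0, T] × closure O × A → ℝ` such that
`h (t, ·)` is continuous on `closure O × A` for each `t`. -/
structure IsClassS (T : ℝ) (O A : Set ℝ) (h : Set.Icc 0 T → closure O → A → ℝ) : Prop where
  measurable : Measurable (fun p : Set.Icc 0 T × closure O × A => h p.1 p.2.1 p.2.2)
  bounded : ∃ C : ℝ, ∀ t x a, |h t x a| ≤ C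
  continuous : ∀ t, Continuous (fun q : closure O × A => h t q.1 q.2)

/-- The assumptions on the coefficients `b`, `σ`, the rewards `f`, `g` and the initial law `m₀`
(a measure on the open set `O`). -/
structure StandingAssumption (T : ℝ) (O A : Set ℝ)
    (b σ : Set.Icc 0 T → ℝ → A → ℝ)
    (f : Set.Icc 0 T → closure O → A → ℝ) (g : Set.Icc 0 T → closure O → ℝ)
    (m₀ : Measure O) : Prop where
  b_measurable : Measurable (fun p : Set.Icc 0 T × ℝ × A => b p.1 p.2.1 p.2.2)
  b_bounded : ∃ C : ℝ, ∀ t x a, |b t x a| ≤ C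
  b_lipschitz : ∃ L : ℝ, ∀ t a x y, |b t x a - b t y a| ≤ L * |x - y|
  σ_nonneg : ∀ t x a, 0 ≤ σ t x a
  σ_measurable : Measurable (fun p : Set.Icc 0 T × ℝ × A => σ p.1 p.2.1 p.2.2)
  σ_bounded : ∃ C : ℝ, ∀ t x a, |σ t x a| ≤ C
  σ_lipschitz : ∃ L : ℝ, ∀ t a x y, |σ t x a - σ t y a| ≤ L * |x - y|
  b_classS : IsClassS T O A (fun t x a => b t x a)
  σ_classS : IsClassS T O A (fun t x a => σ t x a)
  f_measurable : Measurable (fun p : Set.Icc 0 T × closure O × A => f p.1 p.2.1 p.2.2)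
  f_bounded : ∃ C : ℝ, ∀ t x a, |f t x a| ≤ C
  f_usc : ∀ t, UpperSemicontinuous (fun q : closure O × A => f t q.1 q.2)
  g_usc : UpperSemicontinuous (fun p : Set.Icc 0 T × closure O => g p.1 p.2)
  g_bddAbove : ∃ C : ℝ, ∀ t x, g t x ≤ C
  m₀_prob : IsProbabilityMeasure m₀
  m₀_log : Integrable (fun x : O => Real.log (1 + |(x : ℝ)|)) m₀

/-- Lebesgue measure `dt` on `[0, T]`. -/
noncomputable def leb (T : ℝ) : Measure (Set.Icc 0 T) :=
  Measure.comap Subtype.val volume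

/-- The measure flows `(m_t)_{t ∈ [0, T]}` of finite positive Borel measures on `closure O × A`,
with `t ↦ m_t(B)` measurable for every Borel set `B` (this is what a `Kernel` is) and
`∫₀ᵀ m_t(closure O × A) dt < ∞`. Flows that agree for almost every `t` represent the same element
of the space `V`; every element of `V` has such a representative (a flow of signed measures that
is positive for almost every `t` can be set to `0` on a null set of times), and the constraints
and the objective below depend only on the class. -/
def V (T : ℝ) (O A : Set ℝ) : Set (Kernel (Set.Icc 0 T) (closure O × A)) :=
  {m | (∀ t, IsFiniteMeasure (m t)) ∧ ∫⁻ t, m t Set.univ ∂(leb T) < ∞}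

/-- The set `ℛ` of pairs `(μ, m)`, with `μ` a probability measure on `[0, T] × closure O` and `m`
in `V`, such that for all `u ∈ C_b^{1,2}([0, T] × closure O)`
`∫ u dμ = ∫ u(0, x) m₀(dx) + ∫₀ᵀ ∫ (∂ₜu + b ∂ₓu + (σ²/2) ∂ₓₓu)(t, x, a) m_t(dx, da) dt`. -/
def R (T : ℝ) (O A : Set ℝ) (b σ : Set.Icc 0 T → ℝ → A → ℝ) (m₀ : Measure O) :
    Set (ProbabilityMeasure (Set.Icc 0 T × closure O) ×
      Kernel (Set.Icc 0 T) (closure O × A)) :=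
  {p | p.2 ∈ V T O A ∧ ∀ u ut ux uxx : ℝ → ℝ → ℝ, IsC12b T O u ut ux uxx →
    ∫ q, u q.1 q.2 ∂(p.1 : Measure (Set.Icc 0 T × closure O)) =
      ∫ x, u 0 x ∂m₀ +
      ∫ t, ∫ q, (ut t q.1 + (b t q.1 q.2 * ux t q.1 + (σ t q.1 q.2) ^ 2 / 2 * uxx t q.1))
        ∂(p.2 t) ∂(leb T)}

/-- The objective `Γ(μ, m) = ∫₀ᵀ ∫ f(t, x, a) m_t(dx, da) dt + ∫ g dμ`, with values in
`ℝ ∪ {-∞}` for `f` bounded and `g` bounded from above. The second integral is the integral of the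
positive part of `g` minus that of its negative part, so that it is `-∞` when the latter
diverges. -/
noncomputable def Γ (T : ℝ) (O A : Set ℝ)
    (f : Set.Icc 0 T → closure O → A → ℝ) (g : Set.Icc 0 T → closure O → ℝ)
    (p : ProbabilityMeasure (Set.Icc 0 T × closure O) ×
      Kernel (Set.Icc 0 T) (closure O × A)) : EReal :=
  ((∫ t, ∫ q, f t q.1 q.2 ∂(p.2 t) ∂(leb T) : ℝ) : EReal) +
    (((∫⁻ q, ENNReal.ofReal (g q.1 q.2) ∂(p.1 : Measure (Set.Icc 0 T × closure O)) : ℝ≥0∞) : EReal)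
      - ((∫⁻ q, ENNReal.ofReal (-g q.1 q.2)
          ∂(p.1 : Measure (Set.Icc 0 T × closure O)) : ℝ≥0∞) : EReal))

/-- `p = (μ, m)` solves the linear programming problem: it lies in `ℛ` and maximizes `Γ` there. -/
def IsLPSolution (T : ℝ) (O A : Set ℝ) (b σ : Set.Icc 0 T → ℝ → A → ℝ)
    (f : Set.Icc 0 T → closure O → A → ℝ) (g : Set.Icc 0 T → closure O → ℝ) (m₀ : Measure O)
    (p : ProbabilityMeasure (Set.Icc 0 T × closure O) ×
      Kernel (Set.Icc 0 T) (closure O × A)) : Prop :=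
  p ∈ R T O A b σ m₀ ∧ IsMaxOn (Γ T O A f g) (R T O A b σ m₀) p

/-- The flow `m` has the strict control form `m_t(dx, da) = δ_{α(t, x)}(da) m_t(dx, A)`: `m_t` is
the image of its first marginal `m_t(dx, A)` under `x ↦ (x, α(t, x))`. -/
def IsStrictControl (T : ℝ) (O A : Set ℝ) (m : Kernel (Set.Icc 0 T) (closure O × A))
    (α : Set.Icc 0 T × closure O → A) : Prop :=
  Measurable α ∧ ∀ t, m t = (m t).fst.map (fun x => (x, α (t, x)))

/-- The set `K(t, x) = {(b(t, x, a), σ²(t, x, a), z) : a ∈ A, z ≤ f(t, x, a)}`. -/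
def K (T : ℝ) (O A : Set ℝ) (b σ : Set.Icc 0 T → ℝ → A → ℝ)
    (f : Set.Icc 0 T → closure O → A → ℝ) (t : Set.Icc 0 T) (x : closure O) : Set (ℝ × ℝ × ℝ) :=
  {k | ∃ (a : A) (z : ℝ), z ≤ f t x a ∧ k = (b t x a, (σ t x a) ^ 2, z)}

end LPControl

namespace LPControl

open Set Filter Topology
open scoped NNReal

/-! The proof combines compactness with a convexification argument. The flow `m` is encoded by the
single measure `ρ = m_t(dx, da) dt`. Testing the linear constraint with functions of time alone
gives `m_t` mass at most one for almost every `t` (`ae_measure_univ_le_one`), so the time marginal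
of `ρ` is dominated by `dt`. Conversely, every measure so dominated disintegrates into a flow, and
the program becomes one over pairs `(μ, ρ)` (`Admissible`).

Testing with slowly varying cutoffs of `x` gives tightness (`exists_uniform_tail_bound`), and
Prokhorov's theorem yields weak limits. The coefficients are merely measurable in `t`, but
domination of the time marginals lets integrands that are continuous, or semicontinuous, in `(x, a)`
alone pass to the limit (`tendsto_integral_of_continuous_sections`,
`lintegral_le_liminf_of_lowerSemicontinuous_sections`). Hence limits are admissible. Writing `Γ` as
a constant minus a nonnegative `cost`, lower semicontinuous with values in `ℝ≥0∞`, gives an optimal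
pair.

Next, an optimal `ρ` is disintegrated over `(t, x)`. Since `K(t, x)` is closed and convex, the mean
of `(b, σ², f)` lies in it, so some single control has exactly the mean `b` and `σ²` and at least
the mean `f`. The constraint is affine in `(b, σ²)`, so it survives with the same `μ`, and the
reward does not drop. The control is chosen measurably as the least element of a compact set of
suitable controls: the sublevel sets of this choice are projections of Borel sets, hence universally
measurable, and a Borel version exists almost everywhere (`exists_measurable_ae_selection`). -/

/-! ### Analytic sets, universal measurability and measurable selection. -/

theorem isCompact_box (n : ℕ → ℕ) : IsCompact {x : ℕ → ℕ | ∀ i, x i ≤ n i} := by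
  have := isCompact_univ_pi (s := fun i => Set.Iic (n i)) (fun i => (Set.finite_Iic _).isCompact)
  convert this using 1
  ext x
  simp only [Set.mem_pi, Set.mem_univ, Set.mem_Iic, true_imp_iff, Set.mem_ofPred_eq]

/-- In the Baire space, a box `{x | ∀ i, x i ≤ n i}` contained in an open set already has one of
its finite-dimensional truncations contained in it. -/
theorem exists_truncated_box_subset (n : ℕ → ℕ) {V : Set (ℕ → ℕ)} (hV : IsOpen V)
    (hn : {x : ℕ → ℕ | ∀ i, x i ≤ n i} ⊆ V) :
    ∃ k, {x : ℕ → ℕ | ∀ i < k, x i ≤ n i} ⊆ V := by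
  by_contra! h
  simp only [Set.not_subset] at h
  choose x hx hxV using h
  have hK := isCompact_box n
  -- Clipping `x k` to the box provides a convergent subsequence. Coordinate `i` is unaffected by
  -- clipping once `k > i`, so the unclipped points have the same limit, which lies in the box and
  -- yet in the closed complement of `V`.
  obtain ⟨y, hy, φ, hφ, hlim⟩ := hK.tendsto_subseq (x := fun k i => min (x k i) (n i))
    (fun k i => min_le_right _ _)
  refine hV.isClosed_compl.mem_of_tendsto (b := atTop) (f := fun k => x (φ k)) ?_
    (Eventually.of_forall fun k => hxV _) (hn hy)
  rw [tendsto_pi_nhds] at hlim ⊢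
  intro i
  refine (hlim i).congr' ?_
  filter_upwards [eventually_gt_atTop i] with k hk
  exact min_eq_left (hx (φ k) i (hk.trans_le (hφ.id_le k)))

/-- Analytic sets are inner approximable by compact sets for (outer) measure. -/
theorem exists_isCompact_lt_of_analyticSet {S : Type*} [TopologicalSpace S] [MeasurableSpace S]
    (μ : Measure S) [μ.OuterRegular] {s : Set S} (hs : AnalyticSet s)
    {c : ℝ≥0∞} (hc : c < μ s) : ∃ K ⊆ s, IsCompact K ∧ c ≤ μ K := by
  rw [analyticSet_iff_exists_polishSpace_range] at hs
  have hs' : s.Nonempty := by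
    by_contra h
    rw [Set.not_nonempty_iff_eq_empty] at h
    simp [h] at hc
  obtain ⟨β, _, _, f₀, hf₀, rfl⟩ := hs
  have : Nonempty β := by
    obtain ⟨_, b, _⟩ := hs'
    exact ⟨b⟩
  obtain ⟨e, he, he'⟩ := PolishSpace.exists_nat_nat_continuous_surjective β
  set f := f₀ ∘ e
  have hf : Continuous f := hf₀.comp he
  have hr : range f = range f₀ := he'.range_comp _
  rw [← hr] at hc ⊢
  -- Continuity from below along increasing unions holds for arbitrary sets, so each coordinate can
  -- be bounded in turn while the measure of the image stays above `c`.
  have key : ∀ (k : ℕ) (C : Set (ℕ → ℕ)), c < μ (f '' C) →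
      ∃ N, c < μ (f '' (C ∩ {x | x k ≤ N})) := by
    intro k C hC
    have hU : f '' C = ⋃ N, f '' (C ∩ {x | x k ≤ N}) := by
      rw [← image_iUnion, ← inter_iUnion]
      congr 1
      refine (inter_eq_left.2 fun x _ => mem_iUnion.2 ⟨x k, le_refl (x k)⟩).symm
    have hm : Monotone fun N => f '' (C ∩ {x | x k ≤ N}) := fun N M hNM =>
      image_mono (inter_subset_inter_right _ fun x (hx : x k ≤ N) => hx.trans hNM)
    rw [hU, hm.measure_iUnion] at hC
    exact lt_iSup_iff.1 hC
  choose N hN using key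
  let C : ℕ → {C : Set (ℕ → ℕ) // c < μ (f '' C)} := fun k =>
    Nat.rec ⟨univ, by rwa [image_univ]⟩ (fun k C => ⟨C.1 ∩ {x | x k ≤ N k C.1 C.2}, hN k C.1 C.2⟩) k
  let n : ℕ → ℕ := fun k => N k (C k).1 (C k).2
  have hC : ∀ k, (C k).1 = {x | ∀ i < k, x i ≤ n i} := by
    intro k
    induction k with
    | zero => simp [C]
    | succ k ih =>
      have : (C (k + 1)).1 = (C k).1 ∩ {x | x k ≤ n k} := rfl
      rw [this, ih]
      ext x
      simp only [mem_inter_iff, mem_ofPred_eq, Order.lt_add_one_iff]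
      constructor
      · rintro ⟨h1, h2⟩ i hi
        rcases hi.lt_or_eq with h | rfl
        · exact h1 i h
        · exact h2
      · exact fun h => ⟨fun i hi => h i hi.le, h k le_rfl⟩
  have hK := isCompact_box n
  refine ⟨f '' {x | ∀ i, x i ≤ n i}, image_subset_range _ _, hK.image hf, ?_⟩
  -- The sets `f '' C k` decrease, and continuity from above is not available for them. Instead, any
  -- open `U` containing the compact image already contains some `f '' C k`, whose measure exceeds
  -- `c`.
  rw [Set.measure_eq_iInf_isOpen]
  refine le_iInf₂ fun U hU => le_iInf fun hUo => ?_
  obtain ⟨k, hk⟩ := exists_truncated_box_subset n (hUo.preimage hf) (image_subset_iff.1 hU)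
  refine (C k).2.le.trans (measure_mono ?_)
  rw [hC k]
  exact image_subset_iff.2 hk

/-- Analytic sets are universally measurable. -/
theorem nullMeasurableSet_of_analyticSet {S : Type*} [TopologicalSpace S] [T2Space S]
    [MeasurableSpace S] [OpensMeasurableSpace S]
    (μ : Measure S) [IsFiniteMeasure μ] [μ.OuterRegular] {s : Set S} (hs : AnalyticSet s) :
    NullMeasurableSet s μ := by
  rcases eq_or_ne (μ s) 0 with h0 | h0
  · exact NullMeasurableSet.of_null h0
  obtain ⟨u, -, hu, hlim⟩ := exists_seq_strictMono_tendsto' (pos_iff_ne_zero.2 h0)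
  choose K hKs hK hcK using fun n => exists_isCompact_lt_of_analyticSet μ hs (hu n).2
  have hm : MeasurableSet (⋃ n, K n) := MeasurableSet.iUnion fun n => (hK n).measurableSet
  have hsub : ⋃ n, K n ⊆ s := iUnion_subset hKs
  have hle : μ s ≤ μ (⋃ n, K n) :=
    le_of_tendsto' hlim fun n => (hcK n).trans (measure_mono (subset_iUnion K n))
  have hae : (⋃ n, K n : Set S) =ᵐ[μ] toMeasurable μ s :=
    ae_eq_of_subset_of_measure_ge (hsub.trans (subset_toMeasurable μ s))
      (by rwa [measure_toMeasurable]) hm.nullMeasurableSet (measure_ne_top _ _)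
  refine ⟨_, hm, ?_⟩
  have hsub' := subset_toMeasurable μ s
  filter_upwards [hae] with x hx
  refine propext ⟨fun h => ?_, fun h => hsub h⟩
  exact (eq_iff_iff.1 hx).2 (hsub' h)

/-- The projection of a Borel set is universally measurable. -/
theorem nullMeasurableSet_image_fst {S Y : Type*} [TopologicalSpace S] [PolishSpace S]
    [MeasurableSpace S] [BorelSpace S] [TopologicalSpace Y] [PolishSpace Y] [MeasurableSpace Y]
    [BorelSpace Y] (μ : Measure S) [IsFiniteMeasure μ] {B : Set (S × Y)} (hB : MeasurableSet B) :
    NullMeasurableSet (Prod.fst '' B) μ :=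
  nullMeasurableSet_of_analyticSet μ (hB.analyticSet.image_of_continuous continuous_fst)

/-- Measurable selection almost everywhere, from a Borel set with nonempty closed sections. -/
theorem exists_measurable_ae_selection {S : Type*} [TopologicalSpace S] [PolishSpace S]
    [MeasurableSpace S] [BorelSpace S] {A : Set ℝ} (hA : IsCompact A) (μ : Measure S)
    [IsFiniteMeasure μ] {B : Set (S × A)} (hB : MeasurableSet B)
    (hclosed : ∀ s, IsClosed {a | (s, a) ∈ B}) (hne : ∀ s, ∃ a, (s, a) ∈ B) :
    ∃ α : S → A, Measurable α ∧ ∀ᵐ s ∂μ, (s, α s) ∈ B := by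
  have : CompactSpace A := isCompact_iff_compactSpace.1 hA
  have : PolishSpace A := hA.isClosed.polishSpace
  -- The order of `ℝ` makes the selection canonical: `β s ≤ c` holds exactly when the section over
  -- `s` meets `{a ≤ c}`, which is a projection.
  have hleast : ∀ s, ∃ a, IsLeast {a | (s, a) ∈ B} a := fun s =>
    (hclosed s).isCompact.exists_isLeast (hne s)
  choose β hβ using hleast
  have hpre : ∀ c, NullMeasurableSet ((fun s => (β s : ℝ)) ⁻¹' Iic c) μ := by
    intro c
    have : (fun s => (β s : ℝ)) ⁻¹' Iic c = Prod.fst '' (B ∩ {p | (p.2 : ℝ) ≤ c}) := by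
      ext s
      simp only [mem_preimage, mem_Iic, mem_image, mem_inter_iff, mem_ofPred_eq,
        Prod.exists, exists_and_right, exists_eq_right]
      exact ⟨fun h => ⟨β s, (hβ s).1, h⟩,
        fun ⟨a', h1, h2⟩ => (Subtype.coe_le_coe.2 ((hβ s).2 h1)).trans h2⟩
    rw [this]
    exact nullMeasurableSet_image_fst μ
      (hB.inter (measurableSet_le (by fun_prop) measurable_const))
  have hmeas : @Measurable (NullMeasurableSpace S μ) ℝ _ _ fun s => (β s : ℝ) :=
    measurable_of_Iic hpre
  have hnull : NullMeasurable β μ := hmeas.subtype_mk (h := fun s => (β s).2)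
  obtain ⟨α, hα, hαβ⟩ := hnull.aemeasurable
  refine ⟨α, hα, ?_⟩
  filter_upwards [hαβ] with s hs
  rw [← hs]
  exact (hβ s).1

/-! ### Semicontinuity of integrals when the integrand is only measurable in time. -/

section Stable

variable {S Y : Type*} [TopologicalSpace S] [PolishSpace S] [MeasurableSpace S] [BorelSpace S]
  [TopologicalSpace Y] [PolishSpace Y] [MeasurableSpace Y] [BorelSpace Y]

/-- A Borel set with open sections is, up to a set of times of measure zero, a countable union of
measurable rectangles with open second factors. -/
theorem exists_rectangles_of_isOpen_sections (ℓ : Measure S) [IsFiniteMeasure ℓ] {U : Set (S × Y)}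
    (hU : MeasurableSet U) (hopen : ∀ s, IsOpen {y | (s, y) ∈ U}) :
    ∃ (E : TopologicalSpace.countableBasis Y → Set S) (N : Set S), (∀ v, MeasurableSet (E v)) ∧
      MeasurableSet N ∧ ℓ N = 0 ∧ (⋃ v, E v ×ˢ (v : Set Y)) ⊆ U ∧
      U ⊆ (⋃ v, E v ×ˢ (v : Set Y)) ∪ N ×ˢ univ := by
  have hnull : ∀ v : TopologicalSpace.countableBasis Y,
      NullMeasurableSet {s | ∀ y ∈ (v : Set Y), (s, y) ∈ U} ℓ := by
    intro v
    have hv := TopologicalSpace.isOpen_of_mem_countableBasis v.2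
    -- The times at which the section contains a given basic open set form the complement of a
    -- projection of a Borel set.
    have : {s | ∀ y ∈ (v : Set Y), (s, y) ∈ U} = (Prod.fst '' (Uᶜ ∩ univ ×ˢ (v : Set Y)))ᶜ := by
      ext s
      simp only [mem_ofPred_eq, mem_compl_iff, mem_image, mem_inter_iff, mem_prod, mem_univ,
        true_and, Prod.exists, exists_and_right, exists_eq_right, not_exists, not_and]
      exact ⟨fun h y hy hyv => hy (h y hyv), fun h y hyv => by_contra fun hy => h y hy hyv⟩
    rw [this]
    exact (nullMeasurableSet_image_fst ℓ
      (hU.compl.inter (MeasurableSet.univ.prod hv.measurableSet))).compl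
  choose E hEsub hE hEae using fun v => (hnull v).exists_measurable_subset_ae_eq
  set M := ⋃ v : TopologicalSpace.countableBasis Y, {s | ∀ y ∈ (v : Set Y), (s, y) ∈ U} \ E v
  have hM : ℓ M = 0 := measure_iUnion_null fun v => ae_le_set.1 (hEae v).symm.le
  refine ⟨E, toMeasurable ℓ M, hE, measurableSet_toMeasurable _ _, by rwa [measure_toMeasurable],
    iUnion_subset fun v p hp => (hEsub v hp.1 : ∀ y ∈ (v : Set Y), (p.1, y) ∈ U) p.2 hp.2, ?_⟩
  rintro ⟨s, y⟩ hp
  obtain ⟨v, hv, hyv, hvU⟩ :=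
    (TopologicalSpace.isBasis_countableBasis Y).isOpen_iff.1 (hopen s) y hp
  by_cases hs : s ∈ E ⟨v, hv⟩
  · exact Or.inl (mem_iUnion.2 ⟨⟨v, hv⟩, hs, hyv⟩)
  · exact Or.inr ⟨subset_toMeasurable _ _ (mem_iUnion.2 ⟨⟨v, hv⟩, hvU, hs⟩), mem_univ _⟩

/-- Lower semicontinuity on Borel sets with open sections: the portmanteau inequality extends from
open sets to these when the first marginals are dominated by a common finite measure. -/
theorem measure_le_liminf_of_isOpen_sections {ι : Type*} {L : Filter ι} (ℓ : Measure S)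
    [IsFiniteMeasure ℓ] {ρ : Measure (S × Y)} {ρs : ι → Measure (S × Y)}
    (hρ : ρ.fst ≤ ℓ) (hρs : ∀ i, (ρs i).fst ≤ ℓ)
    (hlim : ∀ G, IsOpen G → ρ G ≤ liminf (fun i => ρs i G) L)
    {U : Set (S × Y)} (hU : MeasurableSet U) (hopen : ∀ s, IsOpen {y | (s, y) ∈ U}) :
    ρ U ≤ liminf (fun i => ρs i U) L := by
  obtain ⟨E, N, hE, hN, hN0, hsub, hsup⟩ := exists_rectangles_of_isOpen_sections ℓ hU hopen
  refine ENNReal.le_of_forall_pos_le_add fun ε hε _ => ?_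
  obtain ⟨δ, hδ, hδε⟩ := ENNReal.exists_pos_sum_of_countable (ε := (ε : ℝ≥0∞))
    (by exact_mod_cast hε.ne') (TopologicalSpace.countableBasis Y)
  -- Each `E i` is enlarged to an open set at `ℓ`-cost less than `δ i`. Domination of the first
  -- marginals by `ℓ` turns this into an error at most `ε` for all `ρs i` simultaneously.
  have hGex := fun i => (hE i).exists_isOpen_sdiff_lt (μ := ℓ) (measure_ne_top _ _)
    (ε := δ i) (by exact_mod_cast (hδ i).ne')
  choose G hEG hG _ hGδ using hGex
  set W := ⋃ i, G i ×ˢ (i : Set Y)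
  have hW : IsOpen W := isOpen_iUnion fun i => (hG i).prod
    (TopologicalSpace.isOpen_of_mem_countableBasis i.2)
  have hcyl : ∀ {τ : Measure (S × Y)}, τ.fst ≤ ℓ → ∀ {F : Set S}, MeasurableSet F →
      τ (F ×ˢ univ) ≤ ℓ F := by
    intro τ hτ F hF
    have := hτ F
    rwa [Measure.fst_apply hF, ← prod_univ] at this
  have hUW : ρ U ≤ ρ W := by
    refine (measure_mono hsup).trans ((measure_union_le _ _).trans ?_)
    have h0 : ρ (N ×ˢ univ) = 0 := le_antisymm ((hcyl hρ hN).trans hN0.le) bot_le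
    rw [h0, add_zero]
    exact measure_mono (iUnion_mono fun i => prod_mono (hEG i) subset_rfl)
  have hWU : ∀ i, ρs i W ≤ ρs i U + ε := by
    intro i
    have hWsub : W ⊆ U ∪ (⋃ j, (G j \ E j)) ×ˢ univ := by
      rintro ⟨s, y⟩ h
      obtain ⟨j, hj⟩ := mem_iUnion.1 h
      by_cases hs : s ∈ E j
      · exact Or.inl (hsub (mem_iUnion.2 ⟨j, hs, hj.2⟩))
      · exact Or.inr ⟨mem_iUnion.2 ⟨j, hj.1, hs⟩, mem_univ _⟩
    refine (measure_mono hWsub).trans ((measure_union_le _ _).trans ?_)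
    gcongr
    refine (hcyl (hρs i) (MeasurableSet.iUnion fun j => (hG j).measurableSet.diff (hE j))).trans ?_
    exact (measure_iUnion_le _).trans ((ENNReal.tsum_le_tsum fun j => (hGδ j).le).trans hδε.le)
  calc ρ U ≤ ρ W := hUW
    _ ≤ liminf (fun i => ρs i W) L := hlim W hW
    _ ≤ liminf (fun i => ρs i U + ε) L := liminf_le_liminf (Eventually.of_forall hWU)
    _ ≤ liminf (fun i => ρs i U) L + ε := by
      rcases L.eq_or_neBot with rfl | hL
      · simp
      · exact (liminf_add_const _ _ _ (by isBoundedDefault) (by isBoundedDefault)).le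

/-- Layer-cake representation, followed by Fatou's lemma in the level `t`. -/
theorem lintegral_le_liminf_of_superlevel {Ω : Type*} [MeasurableSpace Ω] {ρ : Measure Ω}
    {ρs : ℕ → Measure Ω} {h : Ω → ℝ} (hm : Measurable h) (h0 : ∀ p, 0 ≤ h p)
    (hlim : ∀ t, ρ {p | t < h p} ≤ liminf (fun i => ρs i {p | t < h p}) atTop) :
    ∫⁻ p, ENNReal.ofReal (h p) ∂ρ ≤ liminf (fun i => ∫⁻ p, ENNReal.ofReal (h p) ∂(ρs i)) atTop := by
  simp_rw [fun τ : Measure Ω => lintegral_eq_lintegral_meas_lt τ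
    (Eventually.of_forall h0) hm.aemeasurable]
  refine (lintegral_mono fun t => hlim t).trans (lintegral_liminf_le fun i => ?_)
  exact Antitone.measurable fun a b hab => measure_mono fun p hp => lt_of_le_of_lt hab hp

/-- Lower semicontinuity of the integral of a nonnegative Borel function that is lower
semicontinuous in the second variable only. -/
theorem lintegral_le_liminf_of_lowerSemicontinuous_sections (ℓ : Measure S)
    [IsFiniteMeasure ℓ] {ρ : Measure (S × Y)} {ρs : ℕ → Measure (S × Y)}
    (hρ : ρ.fst ≤ ℓ) (hρs : ∀ i, (ρs i).fst ≤ ℓ)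
    (hlim : ∀ G, IsOpen G → ρ G ≤ liminf (fun i => ρs i G) atTop)
    {h : S × Y → ℝ} (hm : Measurable h) (h0 : ∀ p, 0 ≤ h p)
    (hlsc : ∀ s, LowerSemicontinuous fun y => h (s, y)) :
    ∫⁻ p, ENNReal.ofReal (h p) ∂ρ ≤ liminf (fun i => ∫⁻ p, ENNReal.ofReal (h p) ∂(ρs i)) atTop := by
  exact lintegral_le_liminf_of_superlevel hm h0 fun t =>
    measure_le_liminf_of_isOpen_sections ℓ hρ hρs hlim (measurableSet_lt measurable_const hm)
      fun s => (hlsc s).isOpen_preimage t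

end Stable

/-! ### Weak compactness and weak limits of finite measures. -/

/-- Sequential Prokhorov theorem for finite measures. -/
theorem exists_subseq_tendsto_of_tight {Ω : Type*} [TopologicalSpace Ω] [PolishSpace Ω]
    [MeasurableSpace Ω] [BorelSpace Ω] [Nonempty Ω] (ρ : ℕ → FiniteMeasure Ω) (C : ℝ≥0)
    (hC : ∀ n, (ρ n).mass ≤ C)
    (ht : ∀ ε : ℝ≥0∞, 0 < ε → ∃ K, IsCompact K ∧ ∀ n, (ρ n : Measure Ω) Kᶜ ≤ ε) :
    ∃ (ρ' : FiniteMeasure Ω) (φ : ℕ → ℕ), StrictMono φ ∧ Tendsto (ρ ∘ φ) atTop (𝓝 ρ') := by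
  obtain ⟨c, -, φ, hφ, hc⟩ := (isCompact_Icc (a := (0 : ℝ≥0)) (b := C)).tendsto_subseq
    (x := fun n => (ρ n).mass) fun n => ⟨bot_le, hC n⟩
  -- Vanishing limit mass forces convergence to `0`. Otherwise the masses eventually exceed `c / 2`,
  -- so normalizing inflates tails by at most `2 / c`, and Prokhorov's theorem for probability
  -- measures applies.
  rcases eq_or_ne c 0 with rfl | hc0
  · exact ⟨0, φ, hφ, FiniteMeasure.tendsto_zero_of_tendsto_zero_mass hc⟩
  have hc2 : c / 2 < c := NNReal.half_lt_self hc0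
  obtain ⟨N, hN⟩ := eventually_atTop.1 (hc.eventually (lt_mem_nhds hc2))
  have hcpos : 0 < c / 2 := by positivity
  have hne : ∀ n, ρ (φ (n + N)) ≠ 0 := fun n h => by
    have := hN (n + N) (by omega)
    simp [h] at this
  have htight : IsTightMeasureSet
      {((μ : ProbabilityMeasure Ω) : Measure Ω) | μ ∈ range fun n => (ρ (φ (n + N))).normalize} := by
    rw [isTightMeasureSet_iff_exists_isCompact_measure_compl_le]
    intro ε hε
    obtain ⟨K, hK, hKε⟩ := ht (ε * (c / 2 : ℝ≥0)) (by positivity)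
    refine ⟨K, hK, ?_⟩
    rintro _ ⟨_, ⟨n, rfl⟩, rfl⟩
    have hlt : c / 2 < (ρ (φ (n + N))).mass := hN (n + N) (by omega)
    rw [FiniteMeasure.toMeasure_normalize_eq_of_nonzero _ (hne n)]
    have h1 := hKε (φ (n + N))
    change ((ρ (φ (n + N))).mass⁻¹ : ℝ≥0) • (ρ (φ (n + N)) : Measure Ω) Kᶜ ≤ ε
    rw [ENNReal.smul_def, smul_eq_mul, ENNReal.coe_inv (hcpos.trans hlt).ne', mul_comm,
      ← div_eq_mul_inv]
    refine ENNReal.div_le_of_le_mul (h1.trans ?_)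
    gcongr
  obtain ⟨p, -, ψ, hψ, hp⟩ := (isCompact_closure_of_isTightMeasureSet htight).tendsto_subseq
    (x := fun n => (ρ (φ (n + N))).normalize) fun n => subset_closure ⟨n, rfl⟩
  refine ⟨c • p.toFiniteMeasure, fun n => φ (ψ n + N), fun a b hab => hφ (by
    have := hψ hab
    omega), ?_⟩
  have hmass : Tendsto (fun n => (ρ (φ (ψ n + N))).mass) atTop (𝓝 c) :=
    hc.comp ((tendsto_add_atTop_nat N).comp hψ.tendsto_atTop)
  rw [FiniteMeasure.tendsto_iff_forall_testAgainstNN_tendsto]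
  intro f
  have h1 : ∀ n, (ρ (φ (ψ n + N))).testAgainstNN f = (ρ (φ (ψ n + N))).mass *
      (ρ (φ (ψ n + N))).normalize.toFiniteMeasure.testAgainstNN f := fun n =>
    FiniteMeasure.testAgainstNN_eq_mass_mul _ _
  have h2 : (c • p.toFiniteMeasure).testAgainstNN f = c * p.toFiniteMeasure.testAgainstNN f :=
    FiniteMeasure.smul_testAgainstNN_apply _ _ _
  simp only [Function.comp_apply, h1, h2]
  refine hmass.mul ?_
  rw [ProbabilityMeasure.tendsto_nhds_iff_toFiniteMeasure_tendsto_nhds,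
    FiniteMeasure.tendsto_iff_forall_testAgainstNN_tendsto] at hp
  exact hp f

/-- The portmanteau inequality on open sets for weakly convergent finite measures. -/
theorem le_liminf_measure_open_of_tendsto {Ω : Type*} [TopologicalSpace Ω]
    [MeasurableSpace Ω] [OpensMeasurableSpace Ω] [HasOuterApproxClosed Ω] {ρs : ℕ → FiniteMeasure Ω}
    {ρ : FiniteMeasure Ω} (h : Tendsto ρs atTop (𝓝 ρ)) {G : Set Ω} (hG : IsOpen G) :
    (ρ : Measure Ω) G ≤ liminf (fun i => (ρs i : Measure Ω) G) atTop := by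
  -- The closed-set inequality for the complement, combined with convergence of total masses, gives
  -- the open-set inequality.
  have hcl := FiniteMeasure.limsup_measure_closed_le_of_tendsto h hG.isClosed_compl
  have hmass : Tendsto (fun i => (ρs i : Measure Ω) univ) atTop (𝓝 ((ρ : Measure Ω) univ)) := by
    simpa using (ENNReal.tendsto_coe.2 h.mass)
  have hB : (ρ : Measure Ω) Gᶜ ≠ ∞ := measure_ne_top _ _
  refine ENNReal.le_of_forall_pos_le_add fun ε hε _ => ?_
  have hε2 : (ε / 2 : ℝ≥0∞) ≠ 0 := by simpa using hε.ne'
  have h1 : ∀ᶠ i in atTop, (ρs i : Measure Ω) Gᶜ < (ρ : Measure Ω) Gᶜ + ε / 2 :=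
    eventually_lt_of_limsup_lt (hcl.trans_lt (ENNReal.lt_add_right hB hε2))
  have h2 : ∀ᶠ i in atTop, (ρ : Measure Ω) univ < (ρs i : Measure Ω) univ + ε / 2 :=
    (hmass.add_const _).eventually (lt_mem_nhds (ENNReal.lt_add_right (measure_ne_top _ _) hε2))
  rw [← liminf_add_const _ _ _ (by isBoundedDefault) (by isBoundedDefault)]
  refine le_liminf_of_le (by isBoundedDefault) ?_
  filter_upwards [h1, h2] with i hi1 hi2
  rw [← measure_add_measure_compl hG.measurableSet,
    ← measure_add_measure_compl (μ := (ρs i : Measure Ω)) hG.measurableSet] at hi2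
  refine (ENNReal.add_le_add_iff_right hB).1 (hi2.le.trans ?_)
  calc (ρs i : Measure Ω) G + (ρs i : Measure Ω) Gᶜ + ε / 2
      ≤ (ρs i : Measure Ω) G + ((ρ : Measure Ω) Gᶜ + ε / 2) + ε / 2 := by gcongr
    _ = (ρs i : Measure Ω) G + (ε / 2 + ε / 2) + (ρ : Measure Ω) Gᶜ := by ring
    _ = _ := by rw [ENNReal.add_halves]

/-- Domination of the first marginal is preserved under weak limits. -/
theorem fst_le_of_tendsto {S Y : Type*} [TopologicalSpace S] [PolishSpace S] [MeasurableSpace S]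
    [BorelSpace S] [TopologicalSpace Y] [PolishSpace Y] [MeasurableSpace Y] [BorelSpace Y]
    (ℓ : Measure S) [IsFiniteMeasure ℓ] {ρ : Measure (S × Y)} {ρs : ℕ → Measure (S × Y)}
    (hρs : ∀ i, (ρs i).fst ≤ ℓ)
    (hlim : ∀ G, IsOpen G → ρ G ≤ liminf (fun i => ρs i G) atTop) : ρ.fst ≤ ℓ := by
  refine Measure.le_iff.2 fun E hE => ?_
  rw [E.measure_eq_iInf_isOpen ℓ]
  refine le_iInf₂ fun G hEG => le_iInf fun hG => ?_
  refine (measure_mono hEG).trans ?_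
  rw [Measure.fst_apply hG.measurableSet]
  refine (hlim _ (hG.preimage continuous_fst)).trans ?_
  refine liminf_le_of_le (by isBoundedDefault) fun b hb => ?_
  obtain ⟨i, hi⟩ := hb.exists
  refine hi.trans ?_
  rw [← Measure.fst_apply hG.measurableSet]
  exact hρs i G

/-- Integrals of bounded Borel functions that are continuous in the second variable only converge
along weakly convergent measures whose first marginals are dominated by a common finite measure. -/
theorem tendsto_integral_of_continuous_sections {S Y : Type*} [TopologicalSpace S] [PolishSpace S]
    [MeasurableSpace S] [BorelSpace S] [TopologicalSpace Y] [PolishSpace Y] [MeasurableSpace Y]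
    [BorelSpace Y] (ℓ : Measure S) [IsFiniteMeasure ℓ] {ρ : FiniteMeasure (S × Y)}
    {ρs : ℕ → FiniteMeasure (S × Y)} (hρs : ∀ i, (ρs i : Measure (S × Y)).fst ≤ ℓ)
    (hlim : Tendsto ρs atTop (𝓝 ρ)) {h : S × Y → ℝ} (hm : Measurable h) {C : ℝ}
    (hC : ∀ p, |h p| ≤ C) (hcont : ∀ s, Continuous fun y => h (s, y)) :
    Tendsto (fun i => ∫ p, h p ∂(ρs i : Measure (S × Y))) atTop
      (𝓝 (∫ p, h p ∂(ρ : Measure (S × Y)))) := by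
  have hopen : ∀ G, IsOpen G → (ρ : Measure (S × Y)) G ≤
      liminf (fun i => (ρs i : Measure (S × Y)) G) atTop :=
    fun G hG => le_liminf_measure_open_of_tendsto hlim hG
  have hρ := fst_le_of_tendsto ℓ hρs hopen
  have hmass : Tendsto (fun i => (ρs i : Measure (S × Y)).real univ) atTop
      (𝓝 ((ρ : Measure (S × Y)).real univ)) := NNReal.tendsto_coe.2 hlim.mass
  -- One-sided bound, applied below to `h` and `-h`. Adding `C` makes the integrand nonnegative, and
  -- convergence of the masses allows subtracting it again.
  have key : ∀ k : S × Y → ℝ, Measurable k → (∀ p, |k p| ≤ C) →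
      (∀ s, Continuous fun y => k (s, y)) → ∀ c < ∫ p, k p ∂(ρ : Measure (S × Y)),
      ∀ᶠ i in atTop, c < ∫ p, k p ∂(ρs i : Measure (S × Y)) := by
    intro k hk hkC hkcont c hc
    have hint : ∀ τ : Measure (S × Y), IsFiniteMeasure τ → Integrable k τ := fun τ _ =>
      Integrable.of_bound hk.aestronglyMeasurable C (Eventually.of_forall hkC)
    have hnn : ∀ p, 0 ≤ C + k p := fun p => by linarith [neg_abs_le (k p), hkC p]
    have hadd : ∀ τ : Measure (S × Y), IsFiniteMeasure τ →
        Integrable (fun p => C + k p) τ := fun τ hτ => (integrable_const C).add (hint τ hτ)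
    have hsum : ∀ τ : Measure (S × Y), IsFiniteMeasure τ →
        ∫ p, (C + k p) ∂τ = C * τ.real univ + ∫ p, k p ∂τ := by
      intro τ hτ
      rw [integral_add (integrable_const C) (hint τ hτ), integral_const, smul_eq_mul, mul_comm]
    have hpos : ∀ τ : Measure (S × Y), IsFiniteMeasure τ →
        0 ≤ C * τ.real univ + ∫ p, k p ∂τ := by
      intro τ hτ
      rw [← hsum τ hτ]
      exact integral_nonneg fun p => hnn p
    have hval : ∀ τ : Measure (S × Y), IsFiniteMeasure τ →
        ∫⁻ p, ENNReal.ofReal (C + k p) ∂τ = ENNReal.ofReal (C * τ.real univ + ∫ p, k p ∂τ) := by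
      intro τ hτ
      rw [← hsum τ hτ, ofReal_integral_eq_lintegral_ofReal (hadd τ hτ) (Eventually.of_forall hnn)]
    have hls := lintegral_le_liminf_of_lowerSemicontinuous_sections ℓ hρ hρs hopen
      (measurable_const.add hk) hnn fun s => (continuous_const.add (hkcont s)).lowerSemicontinuous
    simp only [Pi.add_apply] at hls
    rw [hval _ inferInstance] at hls
    simp_rw [fun i => hval (ρs i : Measure (S × Y)) inferInstance] at hls
    -- The gap `c' - c` absorbs the fluctuation of `C` times the mass.
    obtain ⟨c', hcc', hc'⟩ := exists_between hc
    have hev : ∀ᶠ i in atTop, C * (ρ : Measure (S × Y)).real univ + c' <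
        C * (ρs i : Measure (S × Y)).real univ + ∫ p, k p ∂(ρs i : Measure (S × Y)) := by
      rcases lt_or_ge (C * (ρ : Measure (S × Y)).real univ + c') 0 with hneg | hc0
      · exact Eventually.of_forall fun i => hneg.trans_le (hpos _ inferInstance)
      · have hlt : ENNReal.ofReal (C * (ρ : Measure (S × Y)).real univ + c') <
            ENNReal.ofReal (C * (ρ : Measure (S × Y)).real univ +
              ∫ p, k p ∂(ρ : Measure (S × Y))) :=
          (ENNReal.ofReal_lt_ofReal_iff_of_nonneg hc0).2 (by linarith)
        filter_upwards [eventually_lt_of_lt_liminf (hlt.trans_le hls)] with i hi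
        exact (ENNReal.ofReal_lt_ofReal_iff_of_nonneg hc0).1 hi
    have hev2 : ∀ᶠ i in atTop, C * (ρs i : Measure (S × Y)).real univ <
        C * (ρ : Measure (S × Y)).real univ + (c' - c) :=
      (hmass.const_mul C).eventually (gt_mem_nhds (by linarith))
    filter_upwards [hev, hev2] with i h1 h2
    linarith
  refine tendsto_order.2 ⟨fun c hc => key h hm hC hcont c hc, fun c hc => ?_⟩
  have := key (fun p => -h p) hm.neg (fun p => by rw [abs_neg]; exact hC p)
    (fun s => (hcont s).neg) (-c) (by rw [integral_neg]; linarith)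
  filter_upwards [this] with i hi
  rw [integral_neg] at hi
  linarith

/-! ### Flows versus measures on the product space. -/

variable {T : ℝ} {O A : Set ℝ}

instance isFiniteMeasure_leb (T : ℝ) : IsFiniteMeasure (leb T) := by
  refine ⟨?_⟩
  rw [leb, comap_subtype_coe_apply measurableSet_Icc, image_univ, Subtype.range_coe,
    Real.volume_Icc]
  exact ENNReal.ofReal_lt_top

theorem integral_leb_Icc (h0 : 0 ≤ T) (F : ℝ → ℝ) : ∫ t, F t ∂(leb T) = ∫ s in (0 : ℝ)..T, F s := by
  rw [intervalIntegral.integral_of_le h0, ← integral_Icc_eq_integral_Ioc, leb]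
  exact integral_subtype_comap measurableSet_Icc F

/-- Comparison of finite measures tested on nonnegative bounded continuous functions. -/
theorem measure_le_of_lintegral_continuous_le {S : Type*} [TopologicalSpace S] [PolishSpace S]
    [MeasurableSpace S] [BorelSpace S] (ν ℓ : Measure S) [IsFiniteMeasure ν] [IsFiniteMeasure ℓ]
    (h : ∀ φ : BoundedContinuousFunction S ℝ≥0, ∫⁻ s, φ s ∂ν ≤ ∫⁻ s, φ s ∂ℓ) : ν ≤ ℓ := by
  have hcl : ∀ F : Set S, IsClosed F → ν F ≤ ℓ F := fun F hF =>
    ge_of_tendsto' (HasOuterApproxClosed.tendsto_lintegral_apprSeq hF ℓ) fun n =>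
      (HasOuterApproxClosed.measure_le_lintegral hF ν n).trans (h _)
  refine Measure.le_iff.2 fun E hE => ?_
  rw [hE.measure_eq_iSup_isClosed_of_ne_top (measure_ne_top ν E)]
  exact iSup₂_le fun F hFE => iSup_le fun hF => (hcl F hF).trans (measure_mono hFE)

/-- A bounded function of time with continuous bounded derivative is a test function. -/
theorem isC12b_time (O : Set ℝ) {u ut : ℝ → ℝ} (hut : ContinuousOn ut (Icc 0 T))
    (hd : ∀ t ∈ Icc 0 T, HasDerivWithinAt u (ut t) (Icc 0 T) t) :
    IsC12b T O (fun t _ => u t) (fun t _ => ut t) (fun _ _ => 0) (fun _ _ => 0) := by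
  have hu : ContinuousOn u (Icc 0 T) := fun t ht => (hd t ht).continuousWithinAt
  have hfst : ∀ {v : ℝ → ℝ}, ContinuousOn v (Icc 0 T) →
      ContinuousOn (Function.uncurry fun t _ => v t) (Icc 0 T ×ˢ closure O) := fun hv =>
    hv.comp continuous_fst.continuousOn fun p hp => hp.1
  have hbd : ∀ {v : ℝ → ℝ}, ContinuousOn v (Icc 0 T) →
      ∃ C : ℝ, ∀ t ∈ Icc 0 T, ∀ x ∈ closure O, |v t| ≤ C := fun hv => by
    obtain ⟨C, hC⟩ := isCompact_Icc.exists_bound_of_continuousOn hv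
    exact ⟨C, fun t ht x _ => hC t ht⟩
  exact ⟨hfst hu, hfst hut, continuousOn_const, continuousOn_const, hbd hu, hbd hut,
    ⟨0, by simp⟩, ⟨0, by simp⟩, fun t ht x _ => hd t ht,
    fun t _ x _ => hasDerivWithinAt_const _ _ _, fun t _ x _ => hasDerivWithinAt_const _ _ _⟩

/-- The measure `m_t` has mass at most one for almost every `t`. -/
theorem ae_measure_univ_le_one (hT : 0 < T) {b σ : Icc 0 T → ℝ → A → ℝ} {m₀ : Measure O}
    {μ : ProbabilityMeasure (Icc 0 T × closure O)} {m : Kernel (Icc 0 T) (closure O × A)}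
    (hp : (μ, m) ∈ R T O A b σ m₀) : ∀ᵐ t ∂(leb T), m t univ ≤ 1 := by
  obtain ⟨⟨hfin, hmass⟩, heq⟩ := hp
  have hM : Measurable fun t => m t univ := m.measurable_coe MeasurableSet.univ
  set ν := (leb T).withDensity fun t => m t univ
  have : IsFiniteMeasure ν := isFiniteMeasure_withDensity hmass.ne
  have hle : ν ≤ leb T := by
    refine measure_le_of_lintegral_continuous_le ν (leb T) fun φ => ?_
    -- The test function is `u(t) = ∫₀ᵗ φ`, with `φ` extended continuously to `ℝ`. Since `u`
    -- vanishes at time zero and is at most `∫₀ᵀ φ`, the constraint reads `∫ φ m_t(univ) dt = ∫ u dμ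
    -- ≤ ∫ φ dt`.
    set F : ℝ → ℝ := fun s => φ (projIcc 0 T hT.le s)
    have hF : Continuous F := by
      exact NNReal.continuous_coe.comp (φ.continuous.comp continuous_projIcc)
    have hF0 : ∀ s, 0 ≤ F s := fun s => NNReal.coe_nonneg _
    have hFφ : ∀ t : Icc 0 T, F t = φ t := fun t => by simp [F]
    have hd : ∀ t, HasDerivAt (fun t => ∫ s in (0 : ℝ)..t, F s) (F t) t := fun t =>
      hF.deriv_integral _ 0 t ▸ (intervalIntegral.differentiable_integral_of_continuous hF t).hasDerivAt
    have h1 := heq _ _ _ _ (isC12b_time O hF.continuousOn fun t _ => (hd t).hasDerivWithinAt)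
    simp only [intervalIntegral.integral_same, integral_zero, zero_add, mul_zero, add_zero,
      integral_const, smul_eq_mul] at h1
    have hFint : ∀ τ : Measure (Icc 0 T), IsFiniteMeasure τ → Integrable (fun t : Icc 0 T => F t) τ := by
      intro τ _
      obtain ⟨C, hC⟩ := isCompact_Icc.exists_bound_of_continuousOn (hF.continuousOn (s := Icc 0 T))
      exact Integrable.of_bound (hF.measurable.comp measurable_subtype_coe).aestronglyMeasurable C
        (Eventually.of_forall fun t => hC t t.2)
    have h2 : ∫ q, (∫ s in (0 : ℝ)..(q.1 : ℝ), F s) ∂(μ : Measure (Icc 0 T × closure O)) ≤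
        ∫ s in (0 : ℝ)..T, F s := by
      have hb : ∀ t ∈ Icc 0 T, ∫ s in (0 : ℝ)..t, F s ≤ ∫ s in (0 : ℝ)..T, F s := fun t ht =>
        intervalIntegral.integral_mono_interval le_rfl ht.1 ht.2
          (Eventually.of_forall fun s => hF0 s) (hF.intervalIntegrable _ _)
      calc _ ≤ ∫ q, (∫ s in (0 : ℝ)..T, F s) ∂(μ : Measure (Icc 0 T × closure O)) := by
            refine integral_mono_of_nonneg (Eventually.of_forall fun q => ?_) (integrable_const _)
              (Eventually.of_forall fun q => hb q.1 q.1.2)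
            exact intervalIntegral.integral_nonneg q.1.2.1 fun s _ => hF0 s
        _ = _ := by simp
    rw [h1, ← integral_leb_Icc hT.le] at h2
    have h3 : ∫ t, F t ∂ν = ∫ t, (m t).real univ * F t ∂(leb T) := by
      rw [integral_withDensity_eq_integral_toReal_smul hM
        (Eventually.of_forall fun t => measure_lt_top (m t) univ)]
      rfl
    rw [← h3] at h2
    have hconv : ∀ τ : Measure (Icc 0 T), IsFiniteMeasure τ →
        ∫⁻ t, φ t ∂τ = ENNReal.ofReal (∫ t, F t ∂τ) := by
      intro τ hτ
      rw [ofReal_integral_eq_lintegral_ofReal (hFint τ hτ) (Eventually.of_forall fun t => hF0 t)]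
      simp [hFφ]
    rw [hconv _ inferInstance, hconv _ inferInstance]
    exact ENNReal.ofReal_le_ofReal h2
  refine ae_le_of_forall_setLIntegral_le_of_sigmaFinite hM fun E hE _ => ?_
  rw [← withDensity_apply _ hE]
  simpa using hle E

/-- A kernel on `[0, T]` represents the measure `ρ` on the product space if iterated integrals of
bounded Borel functions are integrals against `ρ`. -/
def Represents {Y : Type*} [MeasurableSpace Y] (m : Kernel (Icc 0 T) Y)
    (ρ : Measure (Icc 0 T × Y)) : Prop :=
  ∀ h : Icc 0 T × Y → ℝ, Measurable h → (∃ C, ∀ p, |h p| ≤ C) →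
    ∫ t, ∫ y, h (t, y) ∂(m t) ∂(leb T) = ∫ p, h p ∂ρ

theorem represents_compProd {Y : Type*} [MeasurableSpace Y] (m : Kernel (Icc 0 T) Y)
    [IsFiniteKernel m] : Represents m (leb T ⊗ₘ m) := by
  rintro h hm ⟨C, hC⟩
  exact (Measure.integral_compProd (Integrable.of_bound hm.aestronglyMeasurable C
    (Eventually.of_forall hC))).symm

/-- Setting `m` to zero where its mass exceeds one alters it on a null set of times only, and yields
a finite kernel whose product with `dt` has time marginal at most `dt`. -/
theorem exists_represents {Y : Type*} [MeasurableSpace Y] (m : Kernel (Icc 0 T) Y)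
    (hm : ∀ᵐ t ∂(leb T), m t univ ≤ 1) :
    ∃ ρ : Measure (Icc 0 T × Y), ρ.fst ≤ leb T ∧ Represents m ρ := by
  classical
  have hs : MeasurableSet {t | m t univ ≤ 1} :=
    measurableSet_le (m.measurable_coe MeasurableSet.univ) measurable_const
  set m' := Kernel.piecewise hs m 0
  have h1 : ∀ t, m' t univ ≤ 1 := by
    intro t
    rw [Kernel.piecewise_apply]
    split_ifs with h
    · exact h
    · simp
  have : IsFiniteKernel m' := ⟨1, ENNReal.one_lt_top, h1⟩
  refine ⟨leb T ⊗ₘ m', Measure.le_iff.2 fun E hE => ?_, fun h hh hC => ?_⟩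
  · rw [Measure.fst_apply hE, ← prod_univ, Measure.compProd_apply_prod hE MeasurableSet.univ]
    exact (lintegral_mono h1).trans (by simp)
  · rw [← represents_compProd m' h hh hC]
    refine integral_congr_ae ?_
    filter_upwards [hm] with t ht
    have : m' t = m t := (Kernel.piecewise_apply ..).trans (if_pos ht)
    rw [this]

/-- Disintegration with respect to Lebesgue measure. -/
theorem exists_kernel_compProd_eq {Y : Type*} [MeasurableSpace Y] [StandardBorelSpace Y]
    [Nonempty Y] (ρ : Measure (Icc 0 T × Y)) (hρ : ρ.fst ≤ leb T) :
    ∃ κ : Kernel (Icc 0 T) Y, IsFiniteKernel κ ∧ leb T ⊗ₘ κ = ρ := by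
  have hfin : IsFiniteMeasure ρ := by
    refine ⟨?_⟩
    rw [← Measure.fst_univ]
    exact (hρ univ).trans_lt (measure_lt_top _ _)
  have hac : ρ.fst ≪ leb T := Measure.absolutelyContinuous_of_le hρ
  -- The density is at most one only almost everywhere; truncation makes the resulting kernel finite
  -- at every time.
  set d : Icc 0 T → ℝ≥0∞ := fun t => min (ρ.fst.rnDeriv (leb T) t) 1
  have hd : Measurable d := (Measure.measurable_rnDeriv _ _).min measurable_const
  have hd1 : d =ᵐ[leb T] ρ.fst.rnDeriv (leb T) := by
    have hle : ρ.fst.rnDeriv (leb T) ≤ᵐ[leb T] fun _ => 1 := by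
      refine ae_le_of_forall_setLIntegral_le_of_sigmaFinite (Measure.measurable_rnDeriv _ _)
        fun E hE _ => ?_
      rw [← withDensity_apply _ hE, Measure.withDensity_rnDeriv_eq _ _ hac]
      simpa using hρ E
    filter_upwards [hle] with t ht
    exact min_eq_left ht
  have hwd : (leb T).withDensity d = ρ.fst := by
    rw [withDensity_congr_ae hd1, Measure.withDensity_rnDeriv_eq _ _ hac]
  set κ := Kernel.withDensity ρ.condKernel fun t _ => d t
  have hdm : Measurable (Function.uncurry fun (t : Icc 0 T) (_ : Y) => d t) := hd.comp measurable_fst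
  have hκ : ∀ t, ∀ E, MeasurableSet E → κ t E = d t * ρ.condKernel t E := by
    intro t E hE
    rw [Kernel.withDensity_apply' _ hdm]
    simp
  have hκfin : IsFiniteKernel κ := by
    refine ⟨1, ENNReal.one_lt_top, fun t => ?_⟩
    rw [hκ t _ MeasurableSet.univ]
    rw [measure_univ, mul_one]
    exact min_le_right _ _
  refine ⟨κ, hκfin, ?_⟩
  ext s hs
  conv_rhs => rw [← ρ.disintegrate ρ.condKernel, ← hwd]
  rw [Measure.compProd_apply hs, Measure.compProd_apply hs,
    lintegral_withDensity_eq_lintegral_mul _ hd (Kernel.measurable_kernel_prodMk_left hs)]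
  refine lintegral_congr fun t => ?_
  rw [hκ t _ (measurable_prodMk_left hs)]
  rfl

/-! ### Cutoff test functions. -/

/-- The smooth cutoff `x² / (1 + x²)`. -/
noncomputable def cutoff (x : ℝ) : ℝ := x ^ 2 / (1 + x ^ 2)

/-- The first derivative of `cutoff`. -/
noncomputable def cutoffDeriv (x : ℝ) : ℝ := 2 * x / (1 + x ^ 2) ^ 2

/-- The second derivative of `cutoff`. -/
noncomputable def cutoffDeriv2 (x : ℝ) : ℝ := (2 - 6 * x ^ 2) / (1 + x ^ 2) ^ 3

theorem one_add_sq_pos (x : ℝ) : 0 < 1 + x ^ 2 := by positivity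

theorem hasDerivAt_cutoff (x : ℝ) : HasDerivAt cutoff (cutoffDeriv x) x := by
  have h := one_add_sq_pos x
  have h1 : HasDerivAt (fun x : ℝ => x ^ 2) (2 * x) x := by simpa using hasDerivAt_pow 2 x
  have := h1.div (h1.const_add 1) h.ne'
  refine this.congr_deriv ?_
  rw [cutoffDeriv]
  congr 1
  ring

theorem hasDerivAt_cutoffDeriv (x : ℝ) : HasDerivAt cutoffDeriv (cutoffDeriv2 x) x := by
  have h := one_add_sq_pos x
  have h1 : HasDerivAt (fun x : ℝ => x ^ 2) (2 * x) x := by simpa using hasDerivAt_pow 2 x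
  have h2 : HasDerivAt (fun x : ℝ => 2 * x) 2 x := by simpa using (hasDerivAt_id x).const_mul 2
  have := h2.div ((h1.const_add 1).pow 2) (pow_pos h 2).ne'
  refine this.congr_deriv ?_
  rw [cutoffDeriv2]
  simp only [Pi.pow_apply]
  field_simp
  ring

theorem cutoff_nonneg (x : ℝ) : 0 ≤ cutoff x := by unfold cutoff; positivity

theorem cutoff_le_one (x : ℝ) : cutoff x ≤ 1 := by
  rw [cutoff, div_le_one (one_add_sq_pos x)]
  linarith

theorem half_le_cutoff {x : ℝ} (hx : 1 ≤ |x|) : 1 / 2 ≤ cutoff x := by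
  have : 1 ≤ x ^ 2 := by
    rw [← sq_abs]
    nlinarith
  rw [cutoff, le_div_iff₀ (one_add_sq_pos x)]
  linarith

theorem abs_cutoffDeriv_le (x : ℝ) : |cutoffDeriv x| ≤ 1 := by
  have h := one_add_sq_pos x
  rw [cutoffDeriv, abs_div, abs_of_pos (pow_pos h 2), div_le_one (pow_pos h 2), abs_le]
  constructor <;> nlinarith [sq_nonneg (x + 1), sq_nonneg (x - 1), sq_nonneg (x ^ 2), sq_nonneg x]

theorem abs_cutoffDeriv2_le (x : ℝ) : |cutoffDeriv2 x| ≤ 6 := by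
  have h := one_add_sq_pos x
  rw [cutoffDeriv2, abs_div, abs_of_pos (pow_pos h 3), div_le_iff₀ (pow_pos h 3), abs_le]
  have : 1 + x ^ 2 ≤ (1 + x ^ 2) ^ 3 := le_self_pow₀ (by nlinarith [sq_nonneg x]) (by norm_num)
  constructor <;> nlinarith [sq_nonneg x]

theorem continuous_cutoff : Continuous cutoff :=
  continuous_iff_continuousAt.2 fun x => (hasDerivAt_cutoff x).continuousAt

theorem continuous_cutoffDeriv : Continuous cutoffDeriv :=
  continuous_iff_continuousAt.2 fun x => (hasDerivAt_cutoffDeriv x).continuousAt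

theorem continuous_cutoffDeriv2 : Continuous cutoffDeriv2 := by
  unfold cutoffDeriv2
  exact Continuous.div (by fun_prop) (by fun_prop) fun x => (pow_pos (one_add_sq_pos x) 3).ne'

/-- The rescaled cutoffs, multiplied by an affine function of time, are test functions. -/
theorem isC12b_cutoff (T : ℝ) (O : Set ℝ) (p q r : ℝ) :
    IsC12b T O (fun t x => (p + q * t) * cutoff (r * x)) (fun _ x => q * cutoff (r * x))
      (fun t x => (p + q * t) * (r * cutoffDeriv (r * x)))
      (fun t x => (p + q * t) * (r * (r * cutoffDeriv2 (r * x)))) := by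
  have haff : ∀ t ∈ Icc 0 T, |p + q * t| ≤ |p| + |q| * T := fun t ht => by
    refine (abs_add_le _ _).trans ?_
    rw [abs_mul, abs_of_nonneg ht.1]
    have := mul_le_mul_of_nonneg_left ht.2 (abs_nonneg q)
    linarith
  have hb : ∀ {v : ℝ → ℝ} {c : ℝ}, (∀ x, |v x| ≤ c) → ∀ t ∈ Icc 0 T, ∀ x ∈ closure O,
      |(p + q * t) * v x| ≤ (|p| + |q| * T) * c := fun hv t ht x _ => by
    rw [abs_mul]
    exact mul_le_mul (haff t ht) (hv x) (abs_nonneg _) ((abs_nonneg _).trans (haff t ht))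
  have h1 : ∀ x, |cutoff x| ≤ 1 := fun x => by
    rw [abs_of_nonneg (cutoff_nonneg x)]
    exact cutoff_le_one x
  have hlin : ∀ x, HasDerivAt (fun x => r * x) r x := fun x => by
    simpa using (hasDerivAt_id x).const_mul r
  have hc := continuous_cutoff
  have hc1 := continuous_cutoffDeriv
  have hc2 := continuous_cutoffDeriv2
  refine ⟨?_, ?_, ?_, ?_, ⟨_, hb fun x => h1 _⟩, ⟨|q| * 1, fun t _ x _ => ?_⟩,
    ⟨_, hb (c := |r| * 1) fun x => ?_⟩, ⟨_, hb (c := |r| * (|r| * 6)) fun x => ?_⟩,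
    fun t ht x hx => ?_, fun t ht x hx => ?_, fun t ht x hx => ?_⟩
  · exact Continuous.continuousOn (by unfold Function.uncurry; fun_prop)
  · exact Continuous.continuousOn (by unfold Function.uncurry; fun_prop)
  · exact Continuous.continuousOn (by unfold Function.uncurry; fun_prop)
  · exact Continuous.continuousOn (by unfold Function.uncurry; fun_prop)
  · rw [abs_mul]
    gcongr
    exact h1 _
  · rw [abs_mul]
    gcongr
    exact abs_cutoffDeriv_le _
  · rw [abs_mul, abs_mul]
    gcongr
    exact abs_cutoffDeriv2_le _
  · have : HasDerivAt (fun s : ℝ => p + q * s) q t := by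
      simpa using ((hasDerivAt_id t).const_mul q).const_add p
    exact (this.mul_const _).hasDerivWithinAt
  · refine (HasDerivAt.const_mul _ ?_).hasDerivWithinAt
    exact ((hasDerivAt_cutoff (r * x)).comp x (hlin x)).congr_deriv (mul_comm _ _)
  · refine (HasDerivAt.const_mul _ (HasDerivAt.const_mul _ ?_)).hasDerivWithinAt
    exact ((hasDerivAt_cutoffDeriv (r * x)).comp x (hlin x)).congr_deriv (mul_comm _ _)

/-! ### Regularity and bounds of the constraint integrand. -/

/-- The integrand `∂ₜu + b ∂ₓu + (σ²/2) ∂ₓₓu` of the linear constraint. -/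
noncomputable def generator (b σ : Icc 0 T → ℝ → A → ℝ) (ut ux uxx : ℝ → ℝ → ℝ)
    (p : Icc 0 T × closure O × A) : ℝ :=
  ut p.1 p.2.1 + (b p.1 p.2.1 p.2.2 * ux p.1 p.2.1 + (σ p.1 p.2.1 p.2.2) ^ 2 / 2 * uxx p.1 p.2.1)

theorem IsC12b.continuous_restrict {v : ℝ → ℝ → ℝ}
    (hv : ContinuousOn (Function.uncurry v) (Icc 0 T ×ˢ closure O)) :
    Continuous fun p : Icc 0 T × closure O => v p.1 p.2 :=
  hv.comp_continuous (f := fun p : Icc 0 T × closure O => ((p.1 : ℝ), (p.2 : ℝ)))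
    (by fun_prop) fun p => ⟨p.1.2, p.2.2⟩

section Generator

variable {b σ : Icc 0 T → ℝ → A → ℝ} {f : Icc 0 T → closure O → A → ℝ}
  {g : Icc 0 T → closure O → ℝ} {m₀ : Measure O} {u ut ux uxx : ℝ → ℝ → ℝ}

theorem measurable_generator (hyp : StandingAssumption T O A b σ f g m₀)
    (hu : IsC12b T O u ut ux uxx) : Measurable (generator (O := O) b σ ut ux uxx) := by
  have hm : Measurable fun p : Icc 0 T × closure O × A => (p.1, p.2.1) := by fun_prop
  have h1 := (IsC12b.continuous_restrict hu.continuousOn_ut).measurable.comp hm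
  have h2 := (IsC12b.continuous_restrict hu.continuousOn_ux).measurable.comp hm
  have h3 := (IsC12b.continuous_restrict hu.continuousOn_uxx).measurable.comp hm
  exact h1.add ((hyp.b_classS.measurable.mul h2).add
    (((hyp.σ_classS.measurable.pow_const 2).div_const 2).mul h3))

theorem continuous_generator (hyp : StandingAssumption T O A b σ f g m₀)
    (hu : IsC12b T O u ut ux uxx) (t : Icc 0 T) :
    Continuous fun y => generator (O := O) b σ ut ux uxx (t, y) := by
  have hm : Continuous fun p : closure O × A => (t, p.1) := by fun_prop
  have h1 := (IsC12b.continuous_restrict hu.continuousOn_ut).comp hm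
  have h2 := (IsC12b.continuous_restrict hu.continuousOn_ux).comp hm
  have h3 := (IsC12b.continuous_restrict hu.continuousOn_uxx).comp hm
  exact h1.add (((hyp.b_classS.continuous t).mul h2).add
    ((((hyp.σ_classS.continuous t).pow 2).div_const 2).mul h3))

theorem abs_generator_le {Cb Cσ C0 C1 C2 : ℝ} (hb : ∀ t x a, |b t x a| ≤ Cb)
    (hσ : ∀ t x a, |σ t x a| ≤ Cσ) (h0 : ∀ t ∈ Icc 0 T, ∀ x ∈ closure O, |ut t x| ≤ C0)
    (h1 : ∀ t ∈ Icc 0 T, ∀ x ∈ closure O, |ux t x| ≤ C1)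
    (h2 : ∀ t ∈ Icc 0 T, ∀ x ∈ closure O, |uxx t x| ≤ C2) (p : Icc 0 T × closure O × A) :
    |generator b σ ut ux uxx p| ≤ C0 + (Cb * C1 + Cσ ^ 2 / 2 * C2) := by
  have hb' := hb p.1 p.2.1 p.2.2
  have hσ' := hσ p.1 p.2.1 p.2.2
  have h1' := h1 p.1 p.1.2 p.2.1 p.2.1.2
  have h2' := h2 p.1 p.1.2 p.2.1 p.2.1.2
  refine (abs_add_le _ _).trans (add_le_add (h0 p.1 p.1.2 p.2.1 p.2.1.2)
    ((abs_add_le _ _).trans (add_le_add ?_ ?_)))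
  · rw [abs_mul]
    exact mul_le_mul hb' h1' (abs_nonneg _) ((abs_nonneg _).trans hb')
  · rw [abs_mul, abs_div, abs_pow, abs_two]
    refine mul_le_mul ?_ h2' (abs_nonneg _) (by positivity)
    gcongr

theorem bounded_generator (hyp : StandingAssumption T O A b σ f g m₀)
    (hu : IsC12b T O u ut ux uxx) : ∃ C, ∀ p, |generator (O := O) b σ ut ux uxx p| ≤ C := by
  obtain ⟨Cb, hb⟩ := hyp.b_bounded
  obtain ⟨Cσ, hσ⟩ := hyp.σ_bounded
  obtain ⟨C0, h0⟩ := hu.bounded_ut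
  obtain ⟨C1, h1⟩ := hu.bounded_ux
  obtain ⟨C2, h2⟩ := hu.bounded_uxx
  exact ⟨_, abs_generator_le hb hσ h0 h1 h2⟩

end Generator

/-! ### Admissible pairs of measures. -/

/-- The linear constraint expressed through the measure `ρ = m_t(dx, da) dt`. -/
structure Admissible (T : ℝ) (O A : Set ℝ) (b σ : Icc 0 T → ℝ → A → ℝ) (m₀ : Measure O)
    (μ : Measure (Icc 0 T × closure O)) (ρ : Measure (Icc 0 T × closure O × A)) : Prop where
  prob : IsProbabilityMeasure μ
  fst_le : ρ.fst ≤ leb T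
  integral_eq : ∀ u ut ux uxx : ℝ → ℝ → ℝ, IsC12b T O u ut ux uxx →
    ∫ q, u q.1 q.2 ∂μ = ∫ x, u 0 x ∂m₀ + ∫ p, generator b σ ut ux uxx p ∂ρ

section Admissible

variable {b σ : Icc 0 T → ℝ → A → ℝ} {f : Icc 0 T → closure O → A → ℝ}
  {g : Icc 0 T → closure O → ℝ} {m₀ : Measure O}

theorem isFiniteMeasure_of_fst_le {Y : Type*} [MeasurableSpace Y] {ρ : Measure (Icc 0 T × Y)}
    (h : ρ.fst ≤ leb T) : IsFiniteMeasure ρ := by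
  refine ⟨?_⟩
  rw [← Measure.fst_univ]
  exact (h univ).trans_lt (measure_lt_top _ _)

theorem leb_univ (T : ℝ) : leb T univ = ENNReal.ofReal T := by
  rw [leb, comap_subtype_coe_apply measurableSet_Icc, image_univ, Subtype.range_coe,
    Real.volume_Icc, sub_zero]

theorem measureReal_univ_le_of_fst_le (hT : 0 < T) {Y : Type*} [MeasurableSpace Y]
    {ρ : Measure (Icc 0 T × Y)} (h : ρ.fst ≤ leb T) : ρ.real univ ≤ T := by
  have h1 := h univ
  rw [Measure.fst_univ, leb_univ] at h1
  exact ENNReal.toReal_le_of_le_ofReal hT.le h1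

/-- A feasible pair of the linear program yields an admissible pair of measures. -/
theorem exists_admissible_of_mem_R (hT : 0 < T) (hyp : StandingAssumption T O A b σ f g m₀)
    {μ : ProbabilityMeasure (Icc 0 T × closure O)} {m : Kernel (Icc 0 T) (closure O × A)}
    (hp : (μ, m) ∈ R T O A b σ m₀) :
    ∃ ρ, Admissible T O A b σ m₀ μ ρ ∧ Represents m ρ := by
  obtain ⟨ρ, hρ, hrep⟩ := exists_represents m (ae_measure_univ_le_one hT hp)
  refine ⟨ρ, ⟨inferInstance, hρ, fun u ut ux uxx hu => ?_⟩, hrep⟩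
  rw [← hrep _ (measurable_generator hyp hu) (bounded_generator hyp hu)]
  exact hp.2 u ut ux uxx hu

/-- Conversely, an admissible pair represented by a finite kernel is feasible. -/
theorem mem_R_of_admissible (hyp : StandingAssumption T O A b σ f g m₀)
    {μ : ProbabilityMeasure (Icc 0 T × closure O)} {m : Kernel (Icc 0 T) (closure O × A)}
    [IsFiniteKernel m] (h : Admissible T O A b σ m₀ μ (leb T ⊗ₘ m)) :
    (μ, m) ∈ R T O A b σ m₀ := by
  refine ⟨⟨fun t => inferInstance, ?_⟩, fun u ut ux uxx hu => ?_⟩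
  · calc ∫⁻ t, m t univ ∂(leb T) ≤ ∫⁻ _, m.bound ∂(leb T) :=
          lintegral_mono fun t => Kernel.measure_le_bound m t univ
      _ < ∞ := by
          rw [lintegral_const]
          exact ENNReal.mul_lt_top m.bound_lt_top (measure_lt_top _ _)
  · rw [h.integral_eq u ut ux uxx hu,
      ← represents_compProd m _ (measurable_generator hyp hu) (bounded_generator hyp hu)]
    rfl

/-- Stopping at time zero is admissible. -/
theorem admissible_stop_at_zero (hT : 0 < T) (hyp : StandingAssumption T O A b σ f g m₀) :
    ∃ μ, Admissible T O A b σ m₀ μ 0 := by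
  have := hyp.m₀_prob
  have hι : Measurable fun x : O => ((⟨0, le_rfl, hT.le⟩ : Icc 0 T),
      (⟨x, subset_closure x.2⟩ : closure O)) :=
    measurable_const.prodMk (Measurable.subtype_mk measurable_subtype_coe)
  refine ⟨m₀.map _, Measure.isProbabilityMeasure_map hι.aemeasurable,
    by rw [Measure.fst_zero]; exact Measure.zero_le _,
    fun u ut ux uxx hu => ?_⟩
  rw [integral_map hι.aemeasurable
    (IsC12b.continuous_restrict hu.continuousOn_u).measurable.aestronglyMeasurable]
  simp

/-- The mass of `ρ` is the mean of the time variable under `μ`. -/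
theorem Admissible.integral_time {μ : Measure (Icc 0 T × closure O)}
    {ρ : Measure (Icc 0 T × closure O × A)} (h : Admissible T O A b σ m₀ μ ρ) :
    ∫ q, (q.1 : ℝ) ∂μ = ρ.real univ := by
  have := h.integral_eq _ _ _ _ (isC12b_time (T := T) O (u := fun t => t) (ut := fun _ => 1)
    continuousOn_const fun t _ => hasDerivWithinAt_id _ _)
  simpa [generator] using this

end Admissible

/-! ### Tightness. -/

instance polishSpace_closure (O : Set ℝ) : PolishSpace (closure O) := isClosed_closure.polishSpace

section Tightness

variable {b σ : Icc 0 T → ℝ → A → ℝ} {f : Icc 0 T → closure O → A → ℝ}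
  {g : Icc 0 T → closure O → ℝ} {m₀ : Measure O}

theorem tendsto_integral_cutoff (m₀ : Measure O) [IsFiniteMeasure m₀] :
    Tendsto (fun n : ℕ => ∫ x : O, cutoff (1 / ((n : ℝ) + 1) * x) ∂m₀) atTop (𝓝 0) := by
  have h0 : ∫ x : O, cutoff (0 * (x : ℝ)) ∂m₀ = 0 := by simp [cutoff]
  rw [← h0]
  refine tendsto_integral_of_dominated_convergence (fun _ => 1) (fun n => ?_) (integrable_const _)
    (fun n => Eventually.of_forall fun x => ?_) (Eventually.of_forall fun x => ?_)
  · exact (continuous_cutoff.comp (by fun_prop)).measurable.aestronglyMeasurable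
  · rw [Real.norm_eq_abs, abs_of_nonneg (cutoff_nonneg _)]
    exact cutoff_le_one _
  · exact (continuous_cutoff.tendsto _).comp (tendsto_one_div_add_atTop_nhds_zero_nat.mul_const _)

/-- Markov's inequality at level `1 / 2`, which `cutoff` reaches outside `(-1, 1)`. -/
theorem measureReal_le_two_mul_integral_cutoff {Ω : Type*} [MeasurableSpace Ω] (τ : Measure Ω)
    [IsFiniteMeasure τ] {ξ : Ω → ℝ} (hξ : Measurable ξ) (n : ℕ) :
    τ.real {ω | (n : ℝ) + 1 ≤ |ξ ω|} ≤ 2 * ∫ ω, cutoff (1 / ((n : ℝ) + 1) * ξ ω) ∂τ := by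
  have hn : (0 : ℝ) < n + 1 := by positivity
  have hint : Integrable (fun ω => cutoff (1 / ((n : ℝ) + 1) * ξ ω)) τ :=
    Integrable.of_bound (continuous_cutoff.measurable.comp (hξ.const_mul _)).aestronglyMeasurable 1
      (Eventually.of_forall fun ω => by
        rw [Real.norm_eq_abs, abs_of_nonneg (cutoff_nonneg _)]
        exact cutoff_le_one _)
  have h1 := mul_meas_ge_le_integral_of_nonneg (μ := τ)
    (Eventually.of_forall fun ω => cutoff_nonneg (1 / ((n : ℝ) + 1) * ξ ω)) hint (1 / 2)
  have h2 : τ.real {ω | (n : ℝ) + 1 ≤ |ξ ω|} ≤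
      τ.real {ω | 1 / 2 ≤ cutoff (1 / ((n : ℝ) + 1) * ξ ω)} := by
    refine measureReal_mono fun ω hω => half_le_cutoff ?_
    rw [abs_mul, abs_of_pos (by positivity : 0 < 1 / ((n : ℝ) + 1)), one_div, inv_mul_eq_div,
      le_div_iff₀ hn, one_mul]
    exact hω
  linarith

/-- Uniform tail bounds for admissible pairs of measures. -/
theorem exists_uniform_tail_bound (hT : 0 < T) (hyp : StandingAssumption T O A b σ f g m₀) :
    ∃ e : ℕ → ℝ, Tendsto e atTop (𝓝 0) ∧ ∀ μ ρ, Admissible T O A b σ m₀ μ ρ → ∀ n : ℕ,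
      μ.real {q | (n : ℝ) + 1 ≤ |(q.2 : ℝ)|} ≤ e n ∧ ρ.real {p | (n : ℝ) + 1 ≤ |(p.2.1 : ℝ)|} ≤ e n := by
  have := hyp.m₀_prob
  obtain ⟨Cb, hCb, hb⟩ : ∃ C, 0 ≤ C ∧ ∀ t x a, |b t x a| ≤ C := by
    obtain ⟨C, hC⟩ := hyp.b_bounded
    exact ⟨|C|, abs_nonneg C, fun t x a => (hC t x a).trans (le_abs_self C)⟩
  obtain ⟨Cσ, hσ⟩ := hyp.σ_bounded
  set c : ℕ → ℝ := fun n => ∫ x : O, cutoff (1 / ((n : ℝ) + 1) * x) ∂m₀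
  -- Bound on the spatial part of the generator for `cutoff (r x)`, whose derivatives are at most
  -- `r` and `6 r²`; it vanishes as `r → 0`.
  set d : ℝ → ℝ := fun r => Cb * r + Cσ ^ 2 / 2 * (r * (r * 6))
  set B : ℕ → ℝ := fun n => c n + T * d (1 / ((n : ℝ) + 1))
  have hd : Tendsto (fun n : ℕ => d (1 / ((n : ℝ) + 1))) atTop (𝓝 0) := by
    have hd0 : d 0 = 0 := by simp [d]
    have hdc : Continuous d := by fun_prop
    exact hd0 ▸ (hdc.tendsto 0).comp tendsto_one_div_add_atTop_nhds_zero_nat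
  have hB : Tendsto B atTop (𝓝 0) := by
    have := (tendsto_integral_cutoff m₀).add (hd.const_mul T)
    rwa [mul_zero, add_zero] at this
  -- The tail of `μ` costs `2 B n` and that of `ρ` costs `2 T B n`; their sum serves for both.
  refine ⟨fun n => 2 * (1 + T) * B n, by simpa using hB.const_mul (2 * (1 + T)), ?_⟩
  intro μ ρ h n
  have := h.prob
  have hρfin := isFiniteMeasure_of_fst_le h.fst_le
  set r : ℝ := 1 / ((n : ℝ) + 1)
  have hr0 : 0 ≤ r := by positivity
  have hc0 : 0 ≤ c n := integral_nonneg fun x => cutoff_nonneg _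
  have hdr : 0 ≤ d r := by positivity
  have hx1 : ∀ {w : ℝ} {k : ℝ}, |w| ≤ k → ∀ x : ℝ, |w * (r * cutoffDeriv (r * x))| ≤ k * r := by
    intro w k hw x
    rw [abs_mul, abs_mul, abs_of_nonneg hr0]
    refine mul_le_mul hw ?_ (by positivity) ((abs_nonneg _).trans hw)
    exact mul_le_of_le_one_right hr0 (abs_cutoffDeriv_le _)
  have hx2 : ∀ {w : ℝ} {k : ℝ}, |w| ≤ k → ∀ x : ℝ,
      |w * (r * (r * cutoffDeriv2 (r * x)))| ≤ k * (r * (r * 6)) := by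
    intro w k hw x
    rw [abs_mul, abs_mul, abs_mul, abs_of_nonneg hr0]
    refine mul_le_mul hw ?_ (by positivity) ((abs_nonneg _).trans hw)
    gcongr
    exact abs_cutoffDeriv2_le _
  have hcut : ∀ x : ℝ, |cutoff (r * x)| ≤ 1 := fun x => by
    rw [abs_of_nonneg (cutoff_nonneg _)]
    exact cutoff_le_one _
  have hcm : Measurable fun x : ℝ => cutoff (r * x) := by
    exact (continuous_cutoff.comp (continuous_const.mul continuous_id)).measurable
  have hrest : ∀ {w : ℝ → ℝ} {k : ℝ}, (∀ t ∈ Icc 0 T, |w t| ≤ k) → ∀ p : Icc 0 T × closure O × A,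
      |generator b σ (fun _ _ => 0) (fun t x => w t * (r * cutoffDeriv (r * x)))
        (fun t x => w t * (r * (r * cutoffDeriv2 (r * x)))) p| ≤ k * d r := by
    intro w k hw p
    refine (abs_generator_le hb hσ (C0 := 0) (fun t _ x _ => by simp)
      (fun t ht x _ => hx1 (hw t ht) x) (fun t ht x _ => hx2 (hw t ht) x) p).trans (le_of_eq ?_)
    simp only [d]
    ring
  have hmass := measureReal_univ_le_of_fst_le hT h.fst_le
  have hintle : ∀ {F : Icc 0 T × closure O × A → ℝ} {k : ℝ}, 0 ≤ k → (∀ p, |F p| ≤ k * d r) →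
      ∫ p, F p ∂ρ ≤ k * (T * d r) := by
    intro F k hk hF
    have h1 : ‖∫ p, F p ∂ρ‖ ≤ k * d r * ρ.real univ :=
      norm_integral_le_of_norm_le_const (Eventually.of_forall hF)
    calc _ ≤ k * d r * ρ.real univ := (le_abs_self _).trans h1
      _ ≤ k * d r * T := by gcongr
      _ = _ := by ring
  have hB0 : 0 ≤ B n := add_nonneg hc0 (mul_nonneg hT.le hdr)
  constructor
  · refine (measureReal_le_two_mul_integral_cutoff μ (ξ := fun q => (q.2 : ℝ)) (by fun_prop) n).trans ?_
    -- For `μ`, the test function is the cutoff itself, without time dependence.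
    have h1 := h.integral_eq _ _ _ _ (isC12b_cutoff T O 1 0 r)
    simp only [zero_mul, add_zero, one_mul] at h1
    rw [h1]
    have h2 := hintle zero_le_one (hrest (w := fun _ => 1) (k := 1) (by simp))
    simp only [one_mul] at h2
    have h3 : 2 * B n ≤ 2 * (1 + T) * B n := by nlinarith [mul_nonneg hT.le hB0]
    refine le_trans ?_ h3
    gcongr
    exact add_le_add le_rfl h2
  · refine (measureReal_le_two_mul_integral_cutoff ρ (ξ := fun p => (p.2.1 : ℝ)) (by fun_prop) n).trans ?_
    -- For `ρ`, the weight `T - t` is used: its time derivative produces `-∫ cutoff dρ`, while the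
    -- `μ`-integral is nonnegative and can be dropped.
    have h1 := h.integral_eq _ _ _ _ (isC12b_cutoff T O T (-1) r)
    have hw : ∀ t ∈ Icc 0 T, |T + -1 * t| ≤ T := fun t ht => by
      rw [abs_le]
      constructor <;> linarith [ht.1, ht.2]
    have h2 := hintle hT.le (hrest hw)
    have h0 : 0 ≤ ∫ q : Icc 0 T × closure O, (T + -1 * (q.1 : ℝ)) * cutoff (r * q.2) ∂μ :=
      integral_nonneg fun q => mul_nonneg (by linarith [q.1.2.2]) (cutoff_nonneg _)
    have hsplit : ∀ p : Icc 0 T × closure O × A, generator b σ (fun _ x => -1 * cutoff (r * x))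
        (fun t x => (T + -1 * t) * (r * cutoffDeriv (r * x)))
        (fun t x => (T + -1 * t) * (r * (r * cutoffDeriv2 (r * x)))) p =
        generator b σ (fun _ _ => 0) (fun t x => (T + -1 * t) * (r * cutoffDeriv (r * x)))
        (fun t x => (T + -1 * t) * (r * (r * cutoffDeriv2 (r * x)))) p -
        cutoff (r * p.2.1) := fun p => by
      simp only [generator]
      ring
    have hm := measurable_generator hyp (isC12b_cutoff T O T (-1) r)
    have hic : Integrable (fun p : Icc 0 T × closure O × A => cutoff (r * p.2.1)) ρ :=
      Integrable.of_bound (hcm.comp (by fun_prop :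
        Measurable fun p : Icc 0 T × closure O × A => (p.2.1 : ℝ))).aestronglyMeasurable 1
        (Eventually.of_forall fun p => hcut _)
    have hig : Integrable (generator (O := O) b σ (fun _ _ => 0)
        (fun t x => (T + -1 * t) * (r * cutoffDeriv (r * x)))
        (fun t x => (T + -1 * t) * (r * (r * cutoffDeriv2 (r * x))))) ρ := by
      refine Integrable.of_bound (Measurable.aestronglyMeasurable ?_) (T * d r)
        (Eventually.of_forall (hrest hw))
      have : generator (O := O) b σ (fun _ _ => 0)
          (fun t x => (T + -1 * t) * (r * cutoffDeriv (r * x)))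
          (fun t x => (T + -1 * t) * (r * (r * cutoffDeriv2 (r * x)))) = fun p =>
          generator b σ (fun _ x => -1 * cutoff (r * x))
          (fun t x => (T + -1 * t) * (r * cutoffDeriv (r * x)))
          (fun t x => (T + -1 * t) * (r * (r * cutoffDeriv2 (r * x)))) p +
          cutoff (r * p.2.1) := by
        funext p
        rw [hsplit]
        ring
      rw [this]
      exact hm.add (hcm.comp (by fun_prop))
    rw [integral_congr_ae (Eventually.of_forall hsplit), integral_sub hig hic] at h1
    simp only [mul_zero, add_zero, integral_const_mul] at h1
    have h4 : ∫ p, cutoff (r * p.2.1) ∂ρ ≤ T * B n := by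
      simp only [B, c]
      rw [mul_add]
      linarith
    have h3 : 2 * (T * B n) ≤ 2 * (1 + T) * B n := by nlinarith
    refine le_trans ?_ h3
    gcongr

end Tightness

/-! ### Existence of an optimal admissible pair. -/

/-- A nonnegative cost, equal to a constant minus the objective of the linear program. -/
noncomputable def cost (f : Icc 0 T → closure O → A → ℝ) (g : Icc 0 T → closure O → ℝ) (C D : ℝ)
    (μ : Measure (Icc 0 T × closure O)) (ρ : Measure (Icc 0 T × closure O × A)) : ℝ≥0∞ :=
  ∫⁻ p, ENNReal.ofReal (C - f p.1 p.2.1 p.2.2) ∂ρ +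
    ∫⁻ q, ENNReal.ofReal (D - (g q.1 q.2 + C * q.1)) ∂μ

section Existence

variable {b σ : Icc 0 T → ℝ → A → ℝ} {f : Icc 0 T → closure O → A → ℝ}
  {g : Icc 0 T → closure O → ℝ} {m₀ : Measure O}

theorem isCompact_closure_abs_le (O : Set ℝ) (r : ℝ) : IsCompact {x : closure O | |(x : ℝ)| ≤ r} := by
  have := (isClosed_closure (s := O)).isClosedEmbedding_subtypeVal.isCompact_preimage
    (isCompact_Icc (a := -r) (b := r))
  convert this using 1
  ext x
  simp [abs_le]

/-- Sequential compactness of the set of admissible pairs. -/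
theorem exists_subseq_admissible (hT : 0 < T) (hA : IsCompact A) (hA' : A.Nonempty)
    (hyp : StandingAssumption T O A b σ f g m₀)
    {μ : ℕ → Measure (Icc 0 T × closure O)} {ρ : ℕ → Measure (Icc 0 T × closure O × A)}
    (h : ∀ n, Admissible T O A b σ m₀ (μ n) (ρ n)) :
    ∃ μ' ρ', Admissible T O A b σ m₀ μ' ρ' ∧ ∃ φ : ℕ → ℕ, StrictMono φ ∧
      (∀ G, IsOpen G → μ' G ≤ liminf (fun i => μ (φ i) G) atTop) ∧
      (∀ G, IsOpen G → ρ' G ≤ liminf (fun i => ρ (φ i) G) atTop) := by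
  have : PolishSpace A := hA.isClosed.polishSpace
  have : CompactSpace A := isCompact_iff_compactSpace.1 hA
  have hμp := fun n => (h n).prob
  have hρf := fun n => isFiniteMeasure_of_fst_le (h n).fst_le
  obtain ⟨e, he, htail⟩ := exists_uniform_tail_bound hT hyp
  have hsmall : ∀ ε : ℝ≥0∞, 0 < ε → ∃ n : ℕ, ∀ i, μ i {q | (n : ℝ) + 1 ≤ |(q.2 : ℝ)|} ≤ ε ∧
      ρ i {p | (n : ℝ) + 1 ≤ |(p.2.1 : ℝ)|} ≤ ε := by
    intro ε hε
    have : Tendsto (fun n => ENNReal.ofReal (e n)) atTop (𝓝 0) := by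
      simpa using ENNReal.tendsto_ofReal he
    obtain ⟨n, hn⟩ := (this.eventually (gt_mem_nhds hε)).exists
    refine ⟨n, fun i => ⟨?_, ?_⟩⟩
    · rw [← ofReal_measureReal]
      exact (ENNReal.ofReal_le_ofReal (htail _ _ (h i) n).1).trans hn.le
    · rw [← ofReal_measureReal]
      exact (ENNReal.ofReal_le_ofReal (htail _ _ (h i) n).2).trans hn.le
  have hK : ∀ n : ℕ, IsCompact {x : closure O | |(x : ℝ)| ≤ (n : ℝ) + 1} := fun n =>
    isCompact_closure_abs_le O _
  have hne : Nonempty (Icc 0 T × closure O) := nonempty_of_isProbabilityMeasure (μ 0)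
  have hneA : Nonempty A := hA'.to_subtype
  have hneX : Nonempty (closure O) := hne.map Prod.snd
  have hneS : Nonempty (Icc 0 T) := hne.map Prod.fst
  have hone : ∀ n, FiniteMeasure.mass (⟨μ n, inferInstance⟩ : FiniteMeasure (Icc 0 T × closure O)) = 1 := fun n => by
    simp [FiniteMeasure.mass]
  obtain ⟨μ', φ, hφ, hμ'⟩ := exists_subseq_tendsto_of_tight
      (fun n => (⟨μ n, inferInstance⟩ : FiniteMeasure _)) 1
      (fun n => (hone n).le) fun ε hε => by
    obtain ⟨n, hn⟩ := hsmall ε hε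
    refine ⟨univ ×ˢ {x : closure O | |(x : ℝ)| ≤ (n : ℝ) + 1}, isCompact_univ.prod (hK n),
      fun i => le_trans (measure_mono fun q hq => ?_) (hn i).1⟩
    simp only [mem_compl_iff, mem_prod, mem_univ, true_and, mem_ofPred_eq, not_le] at hq
    exact hq.le
  obtain ⟨ρ', ψ, hψ, hρ'⟩ := exists_subseq_tendsto_of_tight
      (fun n => (⟨ρ (φ n), inferInstance⟩ : FiniteMeasure _)) T.toNNReal
      (fun n => by
        have h1 := measureReal_univ_le_of_fst_le hT (h (φ n)).fst_le
        exact NNReal.le_toNNReal_of_coe_le h1) fun ε hε => by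
    obtain ⟨n, hn⟩ := hsmall ε hε
    refine ⟨univ ×ˢ ({x : closure O | |(x : ℝ)| ≤ (n : ℝ) + 1} ×ˢ univ),
      isCompact_univ.prod ((hK n).prod isCompact_univ),
      fun i => le_trans (measure_mono fun q hq => ?_) (hn (φ i)).2⟩
    simp only [mem_compl_iff, mem_prod, mem_univ, true_and, and_true, mem_ofPred_eq, not_le] at hq
    exact hq.le
  replace hμ' := hμ'.comp hψ.tendsto_atTop
  refine ⟨μ', ρ', ⟨?_, ?_, fun u ut ux uxx hu => ?_⟩, φ ∘ ψ, hφ.comp hψ,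
    fun G hG => le_liminf_measure_open_of_tendsto hμ' hG,
    fun G hG => le_liminf_measure_open_of_tendsto hρ' hG⟩
  · have hmass := hμ'.mass
    have h1 : μ'.mass = 1 := tendsto_nhds_unique hmass
      (tendsto_const_nhds.congr fun n => (hone (φ (ψ n))).symm)
    refine ⟨?_⟩
    rw [← FiniteMeasure.ennreal_mass, h1, ENNReal.coe_one]
  · exact fst_le_of_tendsto (leb T) (fun i => (h (φ (ψ i))).fst_le)
      fun G hG => le_liminf_measure_open_of_tendsto hρ' hG
  · obtain ⟨C, hC⟩ := hu.bounded_u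
    obtain ⟨C', hC'⟩ := bounded_generator hyp hu
    let v : BoundedContinuousFunction (Icc 0 T × closure O) ℝ :=
      BoundedContinuousFunction.ofNormedAddCommGroup (fun q => u q.1 q.2)
        (IsC12b.continuous_restrict hu.continuousOn_u) C fun q => hC q.1 q.1.2 q.2 q.2.2
    have h1 := FiniteMeasure.tendsto_iff_forall_integral_tendsto.1 hμ' v
    -- Weak convergence alone handles `u`, which is jointly continuous, but not the generator, which
    -- is only measurable in time.
    have h2 := tendsto_integral_of_continuous_sections (leb T)
      (ρs := fun i => ⟨ρ (φ (ψ i)), inferInstance⟩) (fun i => (h (φ (ψ i))).fst_le) hρ'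
      (measurable_generator hyp hu) hC' (continuous_generator hyp hu)
    refine tendsto_nhds_unique h1 ((h2.const_add (∫ x, u 0 x ∂m₀)).congr fun i => ?_)
    exact ((h (φ (ψ i))).integral_eq u ut ux uxx hu).symm

theorem ennreal_liminf_add_le (u v : ℕ → ℝ≥0∞) :
    liminf u atTop + liminf v atTop ≤ liminf (fun i => u i + v i) atTop := by
  have hmono : ∀ w : ℕ → ℝ≥0∞, Monotone fun n => ⨅ i ≥ n, w i := fun w n k hnk =>
    le_iInf₂ fun i hi => iInf₂_le i (hnk.trans hi)
  simp_rw [liminf_eq_iSup_iInf_of_nat]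
  rw [ENNReal.iSup_add_iSup_of_monotone (hmono u) (hmono v)]
  exact iSup_mono fun n => le_iInf₂ fun i hi => add_le_add (iInf₂_le i hi) (iInf₂_le i hi)

/-- Lower semicontinuity of the cost. -/
theorem cost_le_liminf (hA : IsCompact A) (hyp : StandingAssumption T O A b σ f g m₀) {C D : ℝ}
    (hC : ∀ t x a, f t x a ≤ C) (hD : ∀ t x, g t x + C * t ≤ D)
    {μ' : Measure (Icc 0 T × closure O)} {ρ' : Measure (Icc 0 T × closure O × A)}
    {μ : ℕ → Measure (Icc 0 T × closure O)} {ρ : ℕ → Measure (Icc 0 T × closure O × A)}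
    (hρ' : ρ'.fst ≤ leb T) (hρ : ∀ n, (ρ n).fst ≤ leb T)
    (hμlim : ∀ G, IsOpen G → μ' G ≤ liminf (fun i => μ i G) atTop)
    (hρlim : ∀ G, IsOpen G → ρ' G ≤ liminf (fun i => ρ i G) atTop) :
    cost f g C D μ' ρ' ≤ liminf (fun i => cost f g C D (μ i) (ρ i)) atTop := by
  have : PolishSpace A := hA.isClosed.polishSpace
  have hanti : ∀ c : ℝ, Antitone fun x : ℝ => c - x := fun c x y hxy => sub_le_sub_left hxy c
  have hcont : ∀ c : ℝ, Continuous fun x : ℝ => c - x := fun c => by fun_prop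
  have h1 := lintegral_le_liminf_of_lowerSemicontinuous_sections (leb T) hρ' hρ hρlim
    (measurable_const.sub hyp.f_measurable) (fun p => sub_nonneg.2 (hC p.1 p.2.1 p.2.2))
    fun s => (hcont C).comp_upperSemicontinuous_antitone (hyp.f_usc s) (hanti C)
  have hg : UpperSemicontinuous fun q : Icc 0 T × closure O => g q.1 q.2 + C * q.1 :=
    hyp.g_usc.add (Continuous.upperSemicontinuous (by fun_prop))
  have hg' := (hcont D).comp_upperSemicontinuous_antitone hg (hanti D)
  have h2 := lintegral_le_liminf_of_superlevel (hg'.measurable)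
    (fun q => sub_nonneg.2 (hD q.1 q.2)) fun t => hμlim _ (hg'.isOpen_preimage t)
  refine (add_le_add h1 h2).trans (ennreal_liminf_add_le _ _)

/-- The cost has a minimizer among admissible pairs. -/
theorem exists_admissible_minimizer (hT : 0 < T) (hA : IsCompact A) (hA' : A.Nonempty)
    (hyp : StandingAssumption T O A b σ f g m₀) {C D : ℝ}
    (hC : ∀ t x a, f t x a ≤ C) (hD : ∀ t x, g t x + C * t ≤ D) :
    ∃ μ ρ, Admissible T O A b σ m₀ μ ρ ∧ ∀ μ₁ ρ₁, Admissible T O A b σ m₀ μ₁ ρ₁ →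
      cost f g C D μ ρ ≤ cost f g C D μ₁ ρ₁ := by
  obtain ⟨μ₀, hμ₀⟩ := admissible_stop_at_zero hT hyp
  set J : Set ℝ≥0∞ := {c | ∃ μ ρ, Admissible T O A b σ m₀ μ ρ ∧ cost f g C D μ ρ = c}
  have hJ : J.Nonempty := ⟨_, μ₀, 0, hμ₀, rfl⟩
  -- The infimum is taken in `ℝ≥0∞`, so the case where `Γ` is identically `-∞` needs no separate
  -- treatment.
  obtain ⟨c, -, hc, hcJ⟩ := exists_seq_tendsto_sInf hJ (OrderBot.bddBelow J)
  choose μ ρ hμρ hcost using hcJ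
  obtain ⟨μ', ρ', h', φ, hφ, hμlim, hρlim⟩ := exists_subseq_admissible hT hA hA' hyp hμρ
  refine ⟨μ', ρ', h', fun μ₁ ρ₁ h₁ => ?_⟩
  refine (cost_le_liminf hA hyp hC hD h'.fst_le (fun n => (hμρ (φ n)).fst_le) hμlim hρlim).trans ?_
  simp_rw [hcost]
  refine (Tendsto.liminf_eq (u := fun i => c (φ i)) (hc.comp hφ.tendsto_atTop)).le.trans ?_
  exact sInf_le ⟨μ₁, ρ₁, h₁, rfl⟩

end Existence

/-! ### The objective in terms of the cost. -/

variable {b σ : Icc 0 T → ℝ → A → ℝ} {f : Icc 0 T → closure O → A → ℝ}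
  {g : Icc 0 T → closure O → ℝ} {m₀ : Measure O}

/-- The objective of the linear program is a constant minus the cost. -/
theorem Γ_eq_sub_cost (hyp : StandingAssumption T O A b σ f g m₀) {C D : ℝ} (hC0 : 0 ≤ C)
    (hC : ∀ t x a, |f t x a| ≤ C) (hD0 : C * T ≤ D) (hD : ∀ t x, g t x + C * T ≤ D)
    {μ : ProbabilityMeasure (Icc 0 T × closure O)} {m : Kernel (Icc 0 T) (closure O × A)}
    {ρ : Measure (Icc 0 T × closure O × A)} (h : Admissible T O A b σ m₀ μ ρ)
    (hm : Represents m ρ) : Γ T O A f g (μ, m) = (D : EReal) - (cost f g C D μ ρ : EReal) := by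
  have hρ := isFiniteMeasure_of_fst_le h.fst_le
  set τ : Measure (Icc 0 T × closure O) := (μ : Measure (Icc 0 T × closure O))
  have hgm : Measurable fun q : Icc 0 T × closure O => g q.1 q.2 := hyp.g_usc.measurable
  have hfi : Integrable (fun p : Icc 0 T × closure O × A => f p.1 p.2.1 p.2.2) ρ :=
    Integrable.of_bound hyp.f_measurable.aestronglyMeasurable C
      (Eventually.of_forall fun p => hC _ _ _)
  have hF : ∫ t, ∫ q, f t q.1 q.2 ∂(m t) ∂(leb T) = ∫ p, f p.1 p.2.1 p.2.2 ∂ρ :=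
    hm (fun p => f p.1 p.2.1 p.2.2) hyp.f_measurable ⟨C, fun p => hC _ _ _⟩
  set F := ∫ p, f p.1 p.2.1 p.2.2 ∂ρ
  set M := ρ.real univ
  have hti : Integrable (fun q : Icc 0 T × closure O => (q.1 : ℝ)) τ :=
    Integrable.of_bound (by fun_prop) T (Eventually.of_forall fun q => by
      rw [Real.norm_eq_abs, abs_of_nonneg q.1.2.1]
      exact q.1.2.2)
  have hCt : ∀ t : Icc 0 T, C * t ≤ C * T := fun t => mul_le_mul_of_nonneg_left t.2.2 hC0
  have hCt0 : ∀ t : Icc 0 T, 0 ≤ C * t := fun t => mul_nonneg hC0 t.2.1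
  have hI1 : ∫ p, (C - f p.1 p.2.1 p.2.2) ∂ρ = C * M - F := by
    rw [integral_sub (integrable_const C) hfi, integral_const, smul_eq_mul, mul_comm]
  have hnn1 : ∀ p : Icc 0 T × closure O × A, 0 ≤ C - f p.1 p.2.1 p.2.2 := fun p =>
    sub_nonneg.2 ((le_abs_self _).trans (hC _ _ _))
  have hpos1 : 0 ≤ C * M - F := hI1 ▸ integral_nonneg hnn1
  have hi1 : Integrable (fun p : Icc 0 T × closure O × A => C - f p.1 p.2.1 p.2.2) ρ :=
    (integrable_const C).sub hfi
  have hL1 : ∫⁻ p, ENNReal.ofReal (C - f p.1 p.2.1 p.2.2) ∂ρ = ENNReal.ofReal (C * M - F) := by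
    rw [← hI1, ofReal_integral_eq_lintegral_ofReal hi1 (Eventually.of_forall hnn1)]
  have hP : ∫⁻ q, ENNReal.ofReal (g q.1 q.2) ∂τ ≠ ∞ := by
    refine ((lintegral_mono (g := fun _ => ENNReal.ofReal D) fun q => ?_).trans_lt ?_).ne
    · exact ENNReal.ofReal_le_ofReal (by linarith [hD q.1 q.2, hCt0 q.1, hCt q.1])
    · simp
  have hΓ : Γ T O A f g (μ, m) = (F : EReal) +
      (((∫⁻ q, ENNReal.ofReal (g q.1 q.2) ∂τ : ℝ≥0∞) : EReal) -
        ((∫⁻ q, ENNReal.ofReal (-g q.1 q.2) ∂τ : ℝ≥0∞) : EReal)) := by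
    rw [← hF]
    rfl
  rw [hΓ, cost, hL1]
  by_cases hN : ∫⁻ q, ENNReal.ofReal (-g q.1 q.2) ∂τ = ∞
  -- Since `D ≥ C T`, the `μ`-integrand of the cost dominates `-g`. The cost is therefore infinite,
  -- and both sides equal `-∞`.
  · have hle : ∫⁻ q, ENNReal.ofReal (-g q.1 q.2) ∂τ ≤
        ∫⁻ q, ENNReal.ofReal (D - (g q.1 q.2 + C * q.1)) ∂τ :=
      lintegral_mono fun q => ENNReal.ofReal_le_ofReal (by linarith [hCt q.1])
    rw [hN, top_le_iff] at hle
    rw [hN, hle, add_top]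
    simp [sub_eq_add_neg]
  · have hgi : Integrable (fun q : Icc 0 T × closure O => g q.1 q.2) τ := by
      refine ⟨hgm.aestronglyMeasurable, ?_⟩
      have hle : ∀ q : Icc 0 T × closure O, ‖g q.1 q.2‖ₑ ≤
          ENNReal.ofReal (g q.1 q.2) + ENNReal.ofReal (-g q.1 q.2) := fun q => by
        rw [← ofReal_norm, Real.norm_eq_abs]
        rcases abs_cases (g q.1 q.2) with ⟨h1, -⟩ | ⟨h1, -⟩ <;> rw [h1]
        · exact le_self_add
        · exact le_add_self
      refine (lintegral_mono hle).trans_lt ?_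
      rw [lintegral_add_left hgm.ennreal_ofReal]
      exact ENNReal.add_lt_top.2 ⟨lt_top_iff_ne_top.2 hP, lt_top_iff_ne_top.2 hN⟩
    set G := ∫ q, g q.1 q.2 ∂τ with hG
    have hi3 : Integrable (fun q : Icc 0 T × closure O => g q.1 q.2 + C * q.1) τ :=
      hgi.add (hti.const_mul C)
    have hi2 : Integrable (fun q : Icc 0 T × closure O => D - (g q.1 q.2 + C * q.1)) τ :=
      (integrable_const D).sub hi3
    -- The mean of time under `μ` is the mass `M` of `ρ`, so the term `C * M` here cancels the one
    -- in `hI1`; the constant left over is `D` for every admissible pair.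
    have hI2 : ∫ q, (D - (g q.1 q.2 + C * q.1)) ∂τ = D - (G + C * M) := by
      rw [integral_sub (integrable_const D) hi3,
        integral_add hgi (hti.const_mul C), integral_const_mul, h.integral_time]
      simp [M, ← hG]
    have hnn2 : ∀ q : Icc 0 T × closure O, 0 ≤ D - (g q.1 q.2 + C * q.1) := fun q => by
      linarith [hD q.1 q.2, hCt q.1]
    have hpos2 : 0 ≤ D - (G + C * M) := hI2 ▸ integral_nonneg hnn2
    have hL2 : ∫⁻ q, ENNReal.ofReal (D - (g q.1 q.2 + C * q.1)) ∂τ =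
        ENNReal.ofReal (D - (G + C * M)) := by
      rw [← hI2, ofReal_integral_eq_lintegral_ofReal hi2 (Eventually.of_forall hnn2)]
    have hGeq := integral_eq_lintegral_pos_part_sub_lintegral_neg_part hgi
    rw [← hG] at hGeq
    rw [hL2, ← ENNReal.ofReal_add hpos1 hpos2, EReal.coe_ennreal_ofReal,
      max_eq_left (add_nonneg hpos1 hpos2), ← EReal.coe_ennreal_toReal hP,
      ← EReal.coe_ennreal_toReal hN, ← EReal.coe_sub, ← hGeq, ← EReal.coe_add, ← EReal.coe_sub]
    congr 1
    ring

/-! ### Convexity and reduction to strict controls. -/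

/-- The sets `K(t, x)` are closed. -/
theorem isClosed_K (hA : IsCompact A) (hyp : StandingAssumption T O A b σ f g m₀) (t : Icc 0 T)
    (x : closure O) : IsClosed (K T O A b σ f t x) := by
  have : CompactSpace A := isCompact_iff_compactSpace.1 hA
  have hpair : Continuous fun a : A => (x, a) := by fun_prop
  have hb : Continuous fun a => b t x a := (hyp.b_classS.continuous t).comp hpair
  have hσ : Continuous fun a => σ t x a := (hyp.σ_classS.continuous t).comp hpair
  have hf : UpperSemicontinuous fun a => f t x a :=
    UpperSemicontinuous.comp (f := fun q : closure O × A => f t q.1 q.2) (hyp.f_usc t) hpair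
  have hhyp : IsClosed {p : A × ℝ | p.2 ≤ f t x p.1} := hf.IsClosed_hypograph
  have hcl : IsClosed {p : A × ℝ × ℝ × ℝ | p.2.1 = b t x p.1 ∧ p.2.2.1 = σ t x p.1 ^ 2 ∧
      p.2.2.2 ≤ f t x p.1} := by
    refine (isClosed_eq (by fun_prop) (by fun_prop)).inter
      ((isClosed_eq (by fun_prop) (by fun_prop)).inter ?_)
    exact hhyp.preimage (f := fun p : A × ℝ × ℝ × ℝ => (p.1, p.2.2.2)) (by fun_prop)
  -- `K(t, x)` is the projection, along the compact set `A`, of a closed set.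
  have := isClosedMap_snd_of_compactSpace _ hcl
  convert this using 1
  ext ⟨k1, k2, k3⟩
  simp only [K, mem_ofPred_eq, mem_image, Prod.exists, Prod.mk.injEq]
  constructor
  · rintro ⟨a, z, hz, rfl, rfl, rfl⟩
    exact ⟨a, _, _, _, ⟨rfl, rfl, hz⟩, rfl, rfl, rfl⟩
  · rintro ⟨a, _, _, _, ⟨h1, h2, h3⟩, rfl, rfl, rfl⟩
    exact ⟨a, _, h3, h1, h2, rfl⟩

/-- Under convexity of `K(t, x)`, averages over the controls are attained by a single control. -/
theorem exists_control_of_average (hA : IsCompact A) (hyp : StandingAssumption T O A b σ f g m₀)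
    (hK : ∀ t x, Convex ℝ (K T O A b σ f t x)) (t : Icc 0 T) (x : closure O)
    (ν : Measure A) [IsProbabilityMeasure ν] :
    ∃ a, b t x a = ∫ a, b t x a ∂ν ∧ σ t x a ^ 2 = ∫ a, σ t x a ^ 2 ∂ν ∧
      ∫ a, f t x a ∂ν ≤ f t x a := by
  obtain ⟨Cb, hb⟩ := hyp.b_bounded
  obtain ⟨Cσ, hσ⟩ := hyp.σ_bounded
  obtain ⟨Cf, hf⟩ := hyp.f_bounded
  have hpair : Measurable fun a : A => (t, x, a) := by fun_prop
  have ib : Integrable (fun a => b t x a) ν := Integrable.of_bound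
    (hyp.b_classS.measurable.comp hpair).aestronglyMeasurable Cb (Eventually.of_forall fun a => hb _ _ _)
  have iσ : Integrable (fun a => σ t x a ^ 2) ν := Integrable.of_bound
    ((hyp.σ_classS.measurable.comp hpair).pow_const 2).aestronglyMeasurable (Cσ ^ 2)
    (Eventually.of_forall fun a => by
      rw [Real.norm_eq_abs, abs_pow]
      exact pow_le_pow_left₀ (abs_nonneg _) (hσ _ _ _) 2)
  have jf : Integrable (fun a => f t x a) ν := Integrable.of_bound
    (hyp.f_measurable.comp hpair).aestronglyMeasurable Cf (Eventually.of_forall fun a => hf _ _ _)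
  -- The barycenter of a probability measure on a closed convex set belongs to that set.
  have hmem := (hK t x).integral_mem (isClosed_K hA hyp t x)
    (Eventually.of_forall fun a => (⟨a, f t x a, le_rfl, rfl⟩ :
      (b t x a, σ t x a ^ 2, f t x a) ∈ K T O A b σ f t x)) (ib.prodMk (iσ.prodMk jf))
  rw [integral_pair ib (iσ.prodMk jf), integral_pair iσ jf] at hmem
  obtain ⟨a, z, hz, heq⟩ := hmem
  simp only [Prod.mk.injEq] at heq
  exact ⟨a, heq.1.symm, heq.2.1.symm, heq.2.2.trans_le hz⟩

/-- An admissible pair can be replaced by one with a strict control, without increasing the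
cost. -/
theorem exists_strict_control (hA : IsCompact A) (hA' : A.Nonempty)
    (hyp : StandingAssumption T O A b σ f g m₀) (hK : ∀ t x, Convex ℝ (K T O A b σ f t x))
    {C D : ℝ} {μ : Measure (Icc 0 T × closure O)}
    {ρ : Measure (Icc 0 T × closure O × A)} (h : Admissible T O A b σ m₀ μ ρ) (hC : ∀ t x a, f t x a ≤ C) :
    ∃ (τ : Measure (Icc 0 T × closure O)) (α : Icc 0 T × closure O → A), Measurable α ∧
      τ.fst ≤ leb T ∧ Admissible T O A b σ m₀ μ (τ.map fun s => (s.1, s.2, α s)) ∧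
      cost f g C D μ (τ.map fun s => (s.1, s.2, α s)) ≤ cost f g C D μ ρ := by
  have : PolishSpace A := hA.isClosed.polishSpace
  have : CompactSpace A := isCompact_iff_compactSpace.1 hA
  have : Nonempty A := hA'.to_subtype
  have hρ := isFiniteMeasure_of_fst_le h.fst_le
  have hassoc : Measurable fun p : Icc 0 T × closure O × A => ((p.1, p.2.1), p.2.2) := by fun_prop
  have hassoc' : Measurable fun p : (Icc 0 T × closure O) × A => (p.1.1, p.1.2, p.2) := by fun_prop
  -- Regrouping the coordinates allows disintegrating the control given `(t, x)`.
  set ρ' := ρ.map fun p => ((p.1, p.2.1), p.2.2)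
  set τ := ρ'.fst
  set ν := ρ'.condKernel
  have hdis : τ ⊗ₘ ν = ρ' := ρ'.disintegrate ν
  have hρmap : ρ = (τ ⊗ₘ ν).map fun p => (p.1.1, p.1.2, p.2) := by
    rw [hdis, Measure.map_map hassoc' hassoc]
    exact Measure.map_id.symm
  have hm3 : ∀ {k : Icc 0 T × closure O × A → ℝ}, Measurable k →
      Measurable fun s : Icc 0 T × closure O => ∫ a, k (s.1, s.2, a) ∂(ν s) := fun hk =>
    ((hk.comp hassoc').stronglyMeasurable.integral_kernel_prod_right' (κ := ν)).measurable
  have hbm := hm3 hyp.b_classS.measurable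
  have hσm := hm3 (hyp.σ_classS.measurable.pow_const 2)
  have hfm := hm3 hyp.f_measurable
  obtain ⟨α, hα, hsel⟩ := exists_measurable_ae_selection hA τ
    (B := {p | b p.1.1 p.1.2 p.2 = ∫ a, b p.1.1 p.1.2 a ∂(ν p.1) ∧
      σ p.1.1 p.1.2 p.2 ^ 2 = ∫ a, σ p.1.1 p.1.2 a ^ 2 ∂(ν p.1) ∧
      ∫ a, f p.1.1 p.1.2 a ∂(ν p.1) ≤ f p.1.1 p.1.2 p.2}) (by
      refine (measurableSet_eq_fun (hyp.b_classS.measurable.comp hassoc')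
        (hbm.comp measurable_fst)).inter ((measurableSet_eq_fun
        ((hyp.σ_classS.measurable.comp hassoc').pow_const 2) (hσm.comp measurable_fst)).inter
        (measurableSet_le (hfm.comp measurable_fst) (hyp.f_measurable.comp hassoc'))))
    (fun s => by
      have hpair : Continuous fun a : A => (s.2, a) := by fun_prop
      have hbs : Continuous fun a => b s.1 s.2 a := (hyp.b_classS.continuous s.1).comp hpair
      have hσs : Continuous fun a => σ s.1 s.2 a := (hyp.σ_classS.continuous s.1).comp hpair
      have hfs : UpperSemicontinuous fun a => f s.1 s.2 a :=
        UpperSemicontinuous.comp (f := fun q : closure O × A => f s.1 q.1 q.2) (hyp.f_usc s.1) hpair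
      have c1 : IsClosed {a | b s.1 s.2 a = ∫ a, b s.1 s.2 a ∂(ν s)} :=
        isClosed_eq hbs continuous_const
      have c2 : IsClosed {a | σ s.1 s.2 a ^ 2 = ∫ a, σ s.1 s.2 a ^ 2 ∂(ν s)} :=
        isClosed_eq (hσs.pow 2) continuous_const
      have c3 : IsClosed {a | ∫ a, f s.1 s.2 a ∂(ν s) ≤ f s.1 s.2 a} := hfs.isClosed_preimage _
      exact c1.inter (c2.inter c3))
    (fun s => exists_control_of_average hA hyp hK s.1 s.2 (ν s))
  have hαm : Measurable fun s : Icc 0 T × closure O => (s.1, s.2, α s) := by fun_prop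
  have hτ : τ.fst ≤ leb T := by
    have : τ.fst = ρ.fst := by
      simp only [τ, ρ', Measure.fst]
      rw [Measure.map_map measurable_fst hassoc, Measure.map_map measurable_fst (by fun_prop)]
      rfl
    rw [this]
    exact h.fst_le
  refine ⟨τ, α, hα, hτ, ⟨h.prob, ?_, fun u ut ux uxx hu => ?_⟩, ?_⟩
  · have : (τ.map fun s => (s.1, s.2, α s)).fst = τ.fst := by
      rw [Measure.fst, Measure.map_map measurable_fst hαm]
      rfl
    rw [this]
    exact hτ
  · have hgm := measurable_generator hyp hu
    obtain ⟨Cg, hCg⟩ := bounded_generator hyp hu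
    have hgi : Integrable (fun p : (Icc 0 T × closure O) × A =>
        generator b σ ut ux uxx (p.1.1, p.1.2, p.2)) (τ ⊗ₘ ν) :=
      Integrable.of_bound (hgm.comp hassoc').aestronglyMeasurable Cg
        (Eventually.of_forall fun p => hCg _)
    -- The generator is affine in `(b, σ²)`, and `α` reproduces their `ν`-means, so both integrals
    -- agree.
    rw [h.integral_eq u ut ux uxx hu, hρmap,
      integral_map hassoc'.aemeasurable hgm.aestronglyMeasurable,
      integral_map hαm.aemeasurable hgm.aestronglyMeasurable,
      Measure.integral_compProd hgi]
    congr 1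
    refine integral_congr_ae ?_
    filter_upwards [hsel] with s hs
    obtain ⟨h1, h2, -⟩ := hs
    obtain ⟨Cb, hb⟩ := hyp.b_bounded
    obtain ⟨Cσ, hσ⟩ := hyp.σ_bounded
    have hpair : Measurable fun a : A => (s.1, s.2, a) := by fun_prop
    have ib : Integrable (fun a => b s.1 s.2 a) (ν s) := Integrable.of_bound
      (hyp.b_classS.measurable.comp hpair).aestronglyMeasurable Cb
      (Eventually.of_forall fun a => hb _ _ _)
    have iσ : Integrable (fun a => σ s.1 s.2 a ^ 2) (ν s) := Integrable.of_bound
      ((hyp.σ_classS.measurable.comp hpair).pow_const 2).aestronglyMeasurable (Cσ ^ 2)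
      (Eventually.of_forall fun a => by
        rw [Real.norm_eq_abs, abs_pow]
        exact pow_le_pow_left₀ (abs_nonneg _) (hσ _ _ _) 2)
    simp only [generator]
    have i1 := ib.mul_const (ux s.1 s.2)
    have i2 := (iσ.div_const 2).mul_const (uxx s.1 s.2)
    have i3 : Integrable (fun a => b s.1 s.2 a * ux s.1 s.2 + σ s.1 s.2 a ^ 2 / 2 * uxx s.1 s.2)
        (ν s) := i1.add i2
    rw [integral_add (integrable_const _) i3, integral_add i1 i2, integral_mul_const,
      integral_mul_const, integral_div, integral_const, h1, h2]
    simp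
  · have hcm : Measurable fun p : Icc 0 T × closure O × A =>
        ENNReal.ofReal (C - f p.1 p.2.1 p.2.2) := (measurable_const.sub hyp.f_measurable).ennreal_ofReal
    refine add_le_add ?_ le_rfl
    have hcm' : Measurable fun p : (Icc 0 T × closure O) × A =>
        ENNReal.ofReal (C - f p.1.1 p.1.2 p.2) := hcm.comp hassoc'
    conv_rhs => rw [hρmap]
    rw [lintegral_map hcm hαm, lintegral_map hcm hassoc',
      Measure.lintegral_compProd hcm']
    refine lintegral_mono_ae ?_
    filter_upwards [hsel] with s hs
    obtain ⟨-, -, h3⟩ := hs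
    obtain ⟨Cf, hf⟩ := hyp.f_bounded
    have hpair : Measurable fun a : A => (s.1, s.2, a) := by fun_prop
    have jf : Integrable (fun a => f s.1 s.2 a) (ν s) := Integrable.of_bound
      (hyp.f_measurable.comp hpair).aestronglyMeasurable Cf (Eventually.of_forall fun a => hf _ _ _)
    have jc : Integrable (fun a => C - f s.1 s.2 a) (ν s) := (integrable_const C).sub jf
    rw [← ofReal_integral_eq_lintegral_ofReal jc
      (Eventually.of_forall fun a => sub_nonneg.2 (hC _ _ _)),
      integral_sub (integrable_const C) jf]
    refine ENNReal.ofReal_le_ofReal ?_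
    simp only [integral_const, probReal_univ, one_smul]
    linarith

/-- Disintegration of a strict control measure into a strict control flow. -/
theorem exists_strict_kernel {τ : Measure (Icc 0 T × closure O)} (hτ : τ.fst ≤ leb T)
    [Nonempty (closure O)] {α : Icc 0 T × closure O → A} (hα : Measurable α) :
    ∃ m : Kernel (Icc 0 T) (closure O × A), IsFiniteKernel m ∧ IsStrictControl T O A m α ∧
      leb T ⊗ₘ m = τ.map fun s => (s.1, s.2, α s) := by
  obtain ⟨κ, hκ, hdis⟩ := exists_kernel_compProd_eq τ hτ
  have hαm : Measurable fun s : Icc 0 T × closure O => (s.1, s.2, α s) := by fun_prop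
  have hαt : ∀ t, Measurable fun x : closure O => (x, α (t, x)) := fun t => by fun_prop
  have hαs : Measurable fun s : Icc 0 T × closure O => (s.2, α s) := by fun_prop
  -- Pairing with `Kernel.id` carries the time along, since the image map depends on it. The strict
  -- control form then holds for every `t`.
  set m := (Kernel.id ×ₖ κ).map fun s => (s.2, α s)
  have hm : ∀ t, m t = (κ t).map fun x => (x, α (t, x)) := by
    intro t
    ext E hE
    rw [Kernel.map_apply' _ hαs _ hE, Kernel.id_prod_apply' _ _ (hαs hE),
      Measure.map_apply (hαt t) hE]
    rfl
  refine ⟨m, inferInstance, ⟨hα, fun t => ?_⟩, ?_⟩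
  · have : (m t).fst = κ t := by
      rw [hm t, Measure.fst, Measure.map_map measurable_fst (hαt t)]
      exact Measure.map_id
    rw [this, hm t]
  · ext E hE
    rw [Measure.compProd_apply hE, Measure.map_apply hαm hE, ← hdis,
      Measure.compProd_apply (hαm hE)]
    refine lintegral_congr fun t => ?_
    rw [hm t, Measure.map_apply (hαt t) (measurable_prodMk_left hE)]
    rfl

end LPControl

/-! ### Assembly of the main theorem. -/

theorem mainTheorem12 (T : ℝ) (hT : 0 < T) (O A : Set ℝ) (hO : IsOpen O)
    (hA : IsCompact A) (hA' : A.Nonempty)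
    (b σ : Set.Icc 0 T → ℝ → A → ℝ)
    (f : Set.Icc 0 T → closure O → A → ℝ) (g : Set.Icc 0 T → closure O → ℝ)
    (m₀ : Measure O)
    (hyp : LPControl.StandingAssumption T O A b σ f g m₀)
    (hK : ∀ (t : Set.Icc 0 T) (x : closure O), Convex ℝ (LPControl.K T O A b σ f t x)) :
    ∃ (μ : ProbabilityMeasure (Set.Icc 0 T × closure O))
      (m : Kernel (Set.Icc 0 T) (closure O × A)) (α : Set.Icc 0 T × closure O → A),
      LPControl.IsLPSolution T O A b σ f g m₀ (μ, m) ∧ LPControl.IsStrictControl T O A m α := by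
  obtain ⟨C, hC0, hC⟩ : ∃ C, 0 ≤ C ∧ ∀ t x a, |f t x a| ≤ C := by
    obtain ⟨C, hC⟩ := hyp.f_bounded
    exact ⟨|C|, abs_nonneg C, fun t x a => (hC t x a).trans (le_abs_self C)⟩
  obtain ⟨D, hD0, hD⟩ : ∃ D, C * T ≤ D ∧ ∀ t x, g t x + C * T ≤ D := by
    obtain ⟨D, hD⟩ := hyp.g_bddAbove
    -- The absolute value secures `C * T ≤ D` even when the upper bound on `g` is negative.
    exact ⟨|D| + C * T, by linarith [abs_nonneg D],
      fun t x => by linarith [hD t x, le_abs_self D]⟩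
  have hC' : ∀ t x a, f t x a ≤ C := fun t x a => (le_abs_self _).trans (hC t x a)
  have hD' : ∀ (t : Set.Icc 0 T) x, g t x + C * t ≤ D := fun t x => by
    have := mul_le_mul_of_nonneg_left t.2.2 hC0
    linarith [hD t x]
  obtain ⟨μ, ρ, hμρ, hmin⟩ := LPControl.exists_admissible_minimizer hT hA hA' hyp hC' hD'
  obtain ⟨τ, α, hα, hτ, hadm, hcost⟩ :=
    LPControl.exists_strict_control (D := D) hA hA' hyp hK hμρ hC'
  have hprob := hμρ.prob
  have hne : Nonempty (closure O) := (nonempty_of_isProbabilityMeasure μ).map Prod.snd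
  obtain ⟨m, hm, hstrict, hmeq⟩ := LPControl.exists_strict_kernel hτ hα
  have hadm' : LPControl.Admissible T O A b σ m₀
      ((⟨μ, hprob⟩ : ProbabilityMeasure (Set.Icc 0 T × closure O)) : Measure _)
      (LPControl.leb T ⊗ₘ m) := by
    rw [hmeq]
    exact hadm
  refine ⟨⟨μ, hprob⟩, m, α, ⟨LPControl.mem_R_of_admissible hyp hadm', ?_⟩, hstrict⟩
  rintro ⟨μ₁, m₁⟩ hp
  obtain ⟨ρ₁, hρ₁, hrep⟩ := LPControl.exists_admissible_of_mem_R hT hyp hp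
  change LPControl.Γ T O A f g (μ₁, m₁) ≤ LPControl.Γ T O A f g (⟨μ, hprob⟩, m)
  rw [LPControl.Γ_eq_sub_cost hyp hC0 hC hD0 hD hρ₁ hrep,
    LPControl.Γ_eq_sub_cost hyp hC0 hC hD0 hD hadm' (LPControl.represents_compProd m)]
  refine EReal.sub_le_sub le_rfl (EReal.coe_ennreal_le_coe_ennreal_iff.2 ?_)
  rw [hmeq]
  exact hcost.trans (hmin _ _ hρ₁)
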